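/- Let $\mathbb F$ be an algebraically closed field of characteristic $0$, let $n\ge 1$, $\mathcal R=\mathbb F[x_1,\dots,x_n]$, and let $\mathfrak g$ be one of the Lie algebras of polynomial vector fields $W(n)=\mathrm{Der}_{\mathbb F}(\mathcal R)$, $S(n)=\{\sum_i f_i\partial_i\in W(n) : \sum_i\partial_i(f_i)=0\}$, or, when $n=2r$ is even, $H(n)=\{D\in W(n): D \text{ annihilates the 2-form } \sum_{i=1}^r dx_i\wedge dx_{i+r}\}$. Let $\mathcal R\natural U(\mathfrak g)$ be the smash product: the vector space $\mathcal R\otimes_{\mathbb F} U(\mathfrak g)$ with the associative multiplication for which $\mathcal R$ and $U(\mathfrak g)$ are subalgebras, $(f\otimes 1)(1\otimes u)=f\otimes u$, and $Xf-fX=X(f)$ for $X\in\mathfrak g$, $f\in\mathcal R$. A universal Lie-Cartan module is an $\mathcal R\natural U(\mathfrak g)$-module, i.e. a vector space with a $\mathfrak g$-action $\rho$ and an $\mathcal R$-action $\theta$ such that $[\rho(X),\theta(f)]=\theta(X(f))$; these form a category ${}^u\mathscr{LC}$, which contains $\mathcal R$ with its natural actions. A $(\mathfrak g,\mathcal R)$-module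 is a vector space with a $\mathfrak g$-action and an $\mathcal R$-action, with no compatibility required. Let $\omega:\mathcal R\to\mathbb F$ be the algebra homomorphism with kernel $(x_1,\dots,x_n)$. Let $\Gamma$ be the left exact functor from ${}^u\mathscr{LC}$ to $(\mathfrak g,\mathcal R)$-modules given by $\Gamma(M)=\mathrm{Hom}_{{}^u\mathscr{LC}}(\mathcal R,M)$, where $f\in\mathcal R$ acts as the scalar $\omega(f)$ and $X\in\mathfrak g$ acts by $(X\phi)(r)=X(\phi(r))-\phi(X(r))=0$. The $q$-th ${}^u\mathscr{LC}$-cohomology of $M$ is $H^q_{{}^u\mathscr{LC}}(M)=\mathsf R^q\Gamma(M)$, where $\mathsf R^q\Gamma$ is the $q$-th right derived functor of $\Gamma$. Let $\mathbf C(M)$ be the extended Chevalley-Eilenberg complex of $(\mathfrak g,\mathcal R)$-modules $C^q(M)=\mathrm{Hom}_{\mathcal R}(\mathcal R\otimes_{\mathbb F}\bigwedge^q\mathfrak g,M)$, $q\ge 0$, where $f\in\mathcal R$ acts as the scalar $\omega(f)$, $X\in\mathfrak g$ acts by $(X\phi)(r\otimes w)=X(\phi(r\otimes w))-\phi(X(r)\otimes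 w)-\phi(r\otimes X.w)$, and the differential is $$\mathsf d_q\phi(r\otimes g_1\wedge\dots\wedge g_{q+1})=\sum_{s<t}(-1)^{s+t}\phi(r\otimes[g_s,g_t]\wedge g_1\wedge\dots\widehat{g_s}\dots\widehat{g_t}\dots\wedge g_{q+1})+\sum_{s}(-1)^{s+1}r\,g_s\,\phi(1\otimes g_1\wedge\dots\widehat{g_s}\dots\wedge g_{q+1}).$$ Then for every universal Lie-Cartan module $M$ and every $q\ge 0$ there is an isomorphism of $\mathcal R$-modules, natural in $M$, $$H^q_{{}^u\mathscr{LC}}(M)\;\cong\;H^q(\mathbf C(M)).$$ -/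

import Mathlib

set_option linter.unusedSectionVars false
universe u
open CategoryTheory

noncomputable section

namespace UniversalLieCartan

open scoped TensorProduct

section ChevalleyEilenberg

variable {F : Type u} [Field F] {L : Type u} [LieRing L] [LieAlgebra F L]
  {N : Type u} [AddCommGroup N] [Module F N] [LieRingModule L N] [LieModule F L N]

/-- For an alternating `q`-form `φ` on `L` with values in an `L`-module, the form
`X.φ : (v₁,…,v_q) ↦ X(φ(v₁,…,v_q)) - ∑ⱼ φ(v₁,…,[X,vⱼ],…,v_q)`. -/
def altLie {q : ℕ} (X : L) : (L [⋀^Fin q]→ₗ[F] N) →ₗ[F] (L [⋀^Fin q]→ₗ[F] N) where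
  toFun φ :=
    { (LieModule.toEnd F L N X).compMultilinearMap φ.toMultilinearMap -
        ∑ j : Fin q, φ.toMultilinearMap.compLinearMap
          (Function.update (fun _ => LinearMap.id) j (LieAlgebra.ad F L X)) with
      map_eq_zero_of_eq' := by
        intro v i j hv hij
        have key : ∀ k : Fin q, (fun m => (Function.update (fun _ => (LinearMap.id : L →ₗ[F] L)) k
            (LieAlgebra.ad F L X) m) (v m)) = Function.update v k ⁅X, v k⁆ := by
          intro k
          funext m
          by_cases h : m = k
          · subst h; simp
          · simp [h]
        simp only [MultilinearMap.toFun_eq_coe, sub_apply,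
          LinearMap.compMultilinearMap_apply, AlternatingMap.coe_multilinearMap,
          sum_apply, MultilinearMap.compLinearMap_apply, key]
        rw [φ.map_eq_zero_of_eq v hv hij, map_zero, zero_sub, neg_eq_zero,
          ← Finset.sum_subset (Finset.subset_univ {i, j})]
        · rw [Finset.sum_pair hij]
          have : Function.update v j ⁅X, v j⁆ =
              (Function.update v i ⁅X, v i⁆) ∘ Equiv.swap i j := by
            funext m
            by_cases h1 : m = i
            · subst h1; simp [hij, hij.symm, hv]
            · by_cases h2 : m = j
              · subst h2; simp [hv]
              · simp [Equiv.swap_apply_of_ne_of_ne h1 h2, h1, h2]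
          rw [this, φ.map_swap _ hij, add_neg_cancel]
        · intro k _ hk
          simp only [Finset.mem_insert, Finset.mem_singleton, not_or] at hk
          exact φ.map_eq_zero_of_eq _ (by simp [Ne.symm hk.1, Ne.symm hk.2, hv]) hij }
  map_add' := by
    intro φ ψ
    ext v
    simp [Finset.sum_add_distrib]
    abel
  map_smul' := by
    intro c φ
    ext v
    simp [smul_sub, Finset.smul_sum]

theorem altLie_apply {q : ℕ} (X : L) (φ : L [⋀^Fin q]→ₗ[F] N) (v : Fin q → L) :
    altLie X φ v = ⁅X, φ v⁆ - ∑ j, φ (Function.update v j ⁅X, v j⁆) := by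
  have key : ∀ k : Fin q, (fun m => (Function.update (fun _ => (LinearMap.id : L →ₗ[F] L)) k
      (LieAlgebra.ad F L X) m) (v m)) = Function.update v k ⁅X, v k⁆ := by
    intro k
    funext m
    by_cases h : m = k
    · subst h; simp
    · simp [h]
  simp [altLie, key]

theorem altLie_cons {q : ℕ} (X Y : L) (φ : L [⋀^Fin (q + 1)]→ₗ[F] N) (v : Fin q → L) :
    altLie X φ (Fin.cons Y v : Fin (q + 1) → L) =
      altLie X (φ.curryLeft Y) v - φ (Fin.cons ⁅X, Y⁆ v : Fin (q + 1) → L) := by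
  rw [altLie_apply, altLie_apply, Fin.sum_univ_succ]
  simp only [Fin.cons_zero, Fin.cons_succ, Fin.update_cons_zero, ← Fin.cons_update,
    AlternatingMap.curryLeft_apply_apply, Matrix.vecCons]
  abel

theorem altLie_add {q : ℕ} (X Y : L) (φ : L [⋀^Fin q]→ₗ[F] N) :
    altLie (X + Y) φ = altLie X φ + altLie Y φ := by
  ext v
  simp only [altLie_apply, AlternatingMap.add_apply, add_lie, AlternatingMap.map_update_add,
    Finset.sum_add_distrib]
  abel

theorem altLie_smul {q : ℕ} (c : F) (X : L) (φ : L [⋀^Fin q]→ₗ[F] N) :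
    altLie (c • X) φ = c • altLie X φ := by
  ext v
  simp only [altLie_apply, AlternatingMap.smul_apply, smul_lie, AlternatingMap.map_update_smul,
    smul_sub, Finset.smul_sum]

theorem altLie_lie {q : ℕ} (X Y : L) (φ : L [⋀^Fin q]→ₗ[F] N) :
    altLie ⁅X, Y⁆ φ = altLie X (altLie Y φ) - altLie Y (altLie X φ) := by
  induction q with
  | zero =>
    ext v
    simp [altLie_apply]
  | succ q ih =>
    have hc : ∀ (X Z : L) (ψ : L [⋀^Fin (q + 1)]→ₗ[F] N),
        (altLie X ψ).curryLeft Z = altLie X (ψ.curryLeft Z) - ψ.curryLeft ⁅X, Z⁆ := by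
      intro X Z ψ
      ext v
      exact altLie_cons X Z ψ v
    ext v
    obtain ⟨Z, w, rfl⟩ : ∃ Z w, v = (Fin.cons Z w : Fin (q + 1) → L) :=
      ⟨v 0, Fin.tail v, (Fin.cons_self_tail v).symm⟩
    have h1 := hc
    change (altLie ⁅X, Y⁆ φ).curryLeft Z w =
      ((altLie X (altLie Y φ)).curryLeft Z - (altLie Y (altLie X φ)).curryLeft Z) w
    congr 1
    simp only [hc, map_sub, ih, lie_lie]
    abel

/-- The part `∑_{s<t} (-1)^{s+t} φ([v_s,v_t], v₁,…,v̂_s,…,v̂_t,…,v_{q+1})` of the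
Chevalley-Eilenberg differential (the indices start at `0`, which does not affect the signs);
it is empty for `q = 0`. -/
def bracketPart : (q : ℕ) → ((Fin q → L) → N) → (Fin (q + 1) → L) → N
  | 0, _, _ => 0
  | q + 1, φ, v => ∑ t : Fin (q + 2), ∑ s : Fin (q + 1),
      if s.castSucc < t then
        (-1 : ℤ) ^ ((s : ℕ) + (t : ℕ)) •
          φ (Fin.cons ⁅v s.castSucc, v t⁆ fun k => v (t.succAbove (s.succAbove k)))
      else 0

/-- The part `∑_s (-1)^{s+1} v_s φ(v₁,…,v̂_s,…,v_{q+1})` of the Chevalley-Eilenberg differential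
(with indices starting at `0` the sign is `(-1)^s`). -/
def actionPart (q : ℕ) (φ : (Fin q → L) → N) (v : Fin (q + 1) → L) : N :=
  ∑ s : Fin (q + 1), (-1 : ℤ) ^ (s : ℕ) • ⁅v s, φ fun k => v (s.succAbove k)⁆

/-- The Chevalley-Eilenberg differential of a cochain, as a function. -/
def ceFun (q : ℕ) (φ : (Fin q → L) → N) (v : Fin (q + 1) → L) : N :=
  bracketPart q φ v + actionPart q φ v

theorem actionPart_cons (q : ℕ) (φ : (Fin (q + 1) → L) → N) (X : L) (v : Fin (q + 1) → L) :
    actionPart (q + 1) φ (Fin.cons X v) =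
      ⁅X, φ v⁆ - actionPart q (fun w => φ (Fin.cons X w)) v := by
  unfold actionPart
  rw [Fin.sum_univ_succ, sub_eq_add_neg, ← Finset.sum_neg_distrib]
  congr 1
  · simp
  · refine Finset.sum_congr rfl fun s _ => ?_
    have : (fun k : Fin (q + 1) => (Fin.cons X v : Fin (q + 2) → L) (s.succ.succAbove k)) =
        Fin.cons X fun k => v (s.succAbove k) := by
      funext k
      refine Fin.cases ?_ (fun k => ?_) k <;> simp
    rw [this, Fin.cons_succ, Fin.val_succ, pow_succ, mul_neg_one, neg_smul]

theorem bracketPart_cons_one (φ : L [⋀^Fin 1]→ₗ[F] N) (X : L) (v : Fin 1 → L) :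
    bracketPart 1 φ (Fin.cons X v) = - ∑ j, φ (Function.update v j ⁅X, v j⁆) := by
  simp [bracketPart, Fin.sum_univ_succ]
  congr 1
  funext k
  fin_cases k
  simp

theorem cons_removeNth_eq {q : ℕ} (φ : L [⋀^Fin (q + 1)]→ₗ[F] N) (v : Fin (q + 1) → L)
    (t : Fin (q + 1)) (Y : L) :
    φ (Fin.cons Y fun k => v (t.succAbove k)) = (-1 : ℤ) ^ (t : ℕ) • φ (Function.update v t Y) := by
  have h := φ.neg_one_pow_smul_map_insertNth t Y (fun k => v (t.succAbove k))
  have h2 : t.insertNth Y (fun k => v (t.succAbove k)) = Function.update v t Y :=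
    Fin.insertNth_removeNth t Y v
  rw [h2] at h
  exact h.symm

theorem bracketPart_cons (q : ℕ) (φ : L [⋀^Fin (q + 2)]→ₗ[F] N) (X : L) (v : Fin (q + 2) → L) :
    bracketPart (q + 2) φ (Fin.cons X v) = - (∑ j, φ (Function.update v j ⁅X, v j⁆)) -
      bracketPart (q + 1) (φ.curryLeft X) v := by
  simp only [bracketPart]
  rw [Fin.sum_univ_succ]
  have h0 : ∀ s : Fin (q + 2), ¬ (s.castSucc < (0 : Fin (q + 3))) := fun s => by simp
  simp only [h0, if_false, Finset.sum_const_zero, zero_add]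
  rw [← Finset.sum_neg_distrib, ← Finset.sum_sub_distrib]
  refine Finset.sum_congr rfl fun t _ => ?_
  rw [Fin.sum_univ_succ, sub_eq_add_neg, ← Finset.sum_neg_distrib]
  congr 1
  · rw [if_pos (by simp [Fin.lt_def])]
    have : (fun k : Fin (q + 1) => (Fin.cons X v : Fin (q + 3) → L)
        (t.succ.succAbove ((0 : Fin (q + 2)).succAbove k))) = fun k => v (t.succAbove k) := by
      funext k
      simp
    rw [this]
    simp only [Fin.castSucc_zero, Fin.cons_zero, Fin.cons_succ]
    rw [cons_removeNth_eq, smul_smul, ← pow_add]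
    have : (-1 : ℤ) ^ (((0 : Fin (q + 2)) : ℕ) + (t.succ : ℕ) + (t : ℕ)) = -1 := by
      simp only [Fin.val_zero, Fin.val_succ]
      rw [Odd.neg_one_pow]
      exact ⟨t, by ring⟩
    rw [this, neg_one_smul]
  · refine Finset.sum_congr rfl fun s _ => ?_
    have hlt : (s.succ.castSucc < t.succ) ↔ s.castSucc < t := by simp [Fin.lt_def]
    by_cases h : s.castSucc < t
    · rw [if_pos (hlt.2 h), if_pos h]
      have : (fun k : Fin (q + 1) => (Fin.cons X v : Fin (q + 3) → L)
        (t.succ.succAbove (s.succ.succAbove k))) =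
          Fin.cons X fun k => v (t.succAbove (s.succAbove k)) := by
        funext k
        refine Fin.cases ?_ (fun k => ?_) k <;> simp
      rw [this]
      have h3 : (Fin.cons X v : Fin (q + 3) → L) s.succ.castSucc = v s.castSucc := by
        rw [← Fin.succ_castSucc, Fin.cons_succ]
      rw [h3, Fin.cons_succ, AlternatingMap.curryLeft_apply_apply, Matrix.vecCons]
      have h4 : ∀ (Y : L) (w : Fin q → L),
          φ (Fin.cons Y (Fin.cons X w : Fin (q + 1) → L)) =
            - φ (Fin.cons X (Fin.cons Y w : Fin (q + 1) → L)) := by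
        intro Y w
        rw [← φ.map_swap _ (i := (0 : Fin (q + 2))) (j := 1) (by simp)]
        congr 1
        funext k
        refine Fin.cases ?_ (fun k => Fin.cases ?_ (fun k => ?_) k) k
        · simp
        · simp
        · rw [Function.comp_apply, Equiv.swap_apply_of_ne_of_ne]
          · simp
          · simp
          · simp [Fin.ext_iff]
      rw [h4]
      simp only [Fin.val_succ]
      rw [smul_neg]
      congr 2
      rw [show (s : ℕ) + 1 + ((t : ℕ) + 1) = s + t + 2 by ring, pow_add]
      simp
    · rw [if_neg (fun h' => h (hlt.1 h')), if_neg h, neg_zero]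

/-- Cartan's formula in degree `0`. -/
theorem ceFun_cons_zero (φ : L [⋀^Fin 0]→ₗ[F] N) (X : L) (v : Fin 0 → L) :
    ceFun 0 φ (Fin.cons X v) = altLie X φ v := by
  simp [ceFun, bracketPart, actionPart, altLie_apply]

/-- Cartan's formula. -/
theorem ceFun_cons (q : ℕ) (φ : L [⋀^Fin (q + 1)]→ₗ[F] N) (X : L) (v : Fin (q + 1) → L) :
    ceFun (q + 1) φ (Fin.cons X v) = altLie X φ v - ceFun q (φ.curryLeft X) v := by
  have h : (fun w => φ (Fin.cons X w : Fin (q + 1) → L)) = φ.curryLeft X := rfl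
  unfold ceFun
  rw [actionPart_cons, h, altLie_apply]
  cases q with
  | zero => rw [bracketPart_cons_one]; simp [bracketPart]; abel
  | succ q => rw [bracketPart_cons]; abel

theorem ceFun_add (q : ℕ) (φ ψ : (Fin q → L) → N) (v : Fin (q + 1) → L) :
    ceFun q (φ + ψ) v = ceFun q φ v + ceFun q ψ v := by
  have h1 : actionPart q (φ + ψ) v = actionPart q φ v + actionPart q ψ v := by
    simp [actionPart, Finset.sum_add_distrib]
  have h2 : bracketPart q (φ + ψ) v = bracketPart q φ v + bracketPart q ψ v := by
    cases q with
    | zero => simp [bracketPart]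
    | succ q =>
      simp only [bracketPart, ← Finset.sum_add_distrib]
      refine Finset.sum_congr rfl fun t _ => Finset.sum_congr rfl fun s _ => ?_
      split_ifs <;> simp
  rw [ceFun, h1, h2, ceFun, ceFun]
  abel

theorem ceFun_smul (q : ℕ) (c : F) (φ : (Fin q → L) → N) (v : Fin (q + 1) → L) :
    ceFun q (c • φ) v = c • ceFun q φ v := by
  have h1 : actionPart q (c • φ) v = c • actionPart q φ v := by
    simp [actionPart, Finset.smul_sum, smul_comm c]
  have h2 : bracketPart q (c • φ) v = c • bracketPart q φ v := by
    cases q with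
    | zero => simp [bracketPart]
    | succ q =>
      simp only [bracketPart, Finset.smul_sum]
      refine Finset.sum_congr rfl fun t _ => Finset.sum_congr rfl fun s _ => ?_
      split_ifs <;> simp [smul_comm c]
  rw [ceFun, h1, h2, ceFun, smul_add]

theorem ceFun_alt_add (q : ℕ) (φ ψ : L [⋀^Fin q]→ₗ[F] N) (v : Fin (q + 1) → L) :
    ceFun q ⇑(φ + ψ) v = ceFun q φ v + ceFun q ψ v :=
  ceFun_add q φ ψ v

theorem ceFun_alt_smul (q : ℕ) (c : F) (φ : L [⋀^Fin q]→ₗ[F] N) (v : Fin (q + 1) → L) :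
    ceFun q ⇑(c • φ) v = c • ceFun q φ v :=
  ceFun_smul q c φ v

theorem ceFun_alt_zero (q : ℕ) (v : Fin (q + 1) → L) :
    ceFun q ⇑(0 : L [⋀^Fin q]→ₗ[F] N) v = 0 := by
  simpa using ceFun_alt_smul q (0 : F) (0 : L [⋀^Fin q]→ₗ[F] N) v

theorem exists_cons {q : ℕ} (v : Fin (q + 1) → L) :
    ∃ X w, v = (Fin.cons X w : Fin (q + 1) → L) :=
  ⟨v 0, Fin.tail v, (Fin.cons_self_tail v).symm⟩

theorem ceFun_update_add (q : ℕ) (φ : L [⋀^Fin q]→ₗ[F] N) (v : Fin (q + 1) → L)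
    (i : Fin (q + 1)) (x y : L) :
    ceFun q φ (Function.update v i (x + y)) =
      ceFun q φ (Function.update v i x) + ceFun q φ (Function.update v i y) := by
  induction q with
  | zero =>
    obtain ⟨X, w, rfl⟩ := exists_cons v
    obtain rfl : i = 0 := Fin.fin_one_eq_zero i
    simp only [Fin.update_cons_zero, ceFun_cons_zero, altLie_add, AlternatingMap.add_apply]
  | succ q ih =>
    obtain ⟨X, w, rfl⟩ := exists_cons v
    refine Fin.cases ?_ (fun i => ?_) i
    · simp only [Fin.update_cons_zero, ceFun_cons, altLie_add, AlternatingMap.add_apply, map_add,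
        ceFun_alt_add]
      abel
    · simp only [← Fin.cons_update, ceFun_cons, AlternatingMap.map_update_add, ih]
      abel

theorem ceFun_update_smul (q : ℕ) (φ : L [⋀^Fin q]→ₗ[F] N) (v : Fin (q + 1) → L)
    (i : Fin (q + 1)) (c : F) (x : L) :
    ceFun q φ (Function.update v i (c • x)) = c • ceFun q φ (Function.update v i x) := by
  induction q with
  | zero =>
    obtain ⟨X, w, rfl⟩ := exists_cons v
    obtain rfl : i = 0 := Fin.fin_one_eq_zero i
    simp only [Fin.update_cons_zero, ceFun_cons_zero, altLie_smul, AlternatingMap.smul_apply]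
  | succ q ih =>
    obtain ⟨X, w, rfl⟩ := exists_cons v
    refine Fin.cases ?_ (fun i => ?_) i
    · simp only [Fin.update_cons_zero, ceFun_cons, altLie_smul, AlternatingMap.smul_apply, map_smul,
        ceFun_alt_smul, smul_sub]
    · simp only [← Fin.cons_update, ceFun_cons, AlternatingMap.map_update_smul, ih, smul_sub]

theorem ceFun_swap (q : ℕ) (φ : L [⋀^Fin (q + 1)]→ₗ[F] N) (X Y : L) (v : Fin q → L) :
    ceFun (q + 1) φ (Fin.cons X (Fin.cons Y v : Fin (q + 1) → L)) +
      ceFun (q + 1) φ (Fin.cons Y (Fin.cons X v : Fin (q + 1) → L)) = 0 := by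
  have hs : ⁅Y, X⁆ = -⁅X, Y⁆ := (lie_skew Y X).symm
  have hn : φ.curryLeft (-⁅X, Y⁆) v = - φ.curryLeft ⁅X, Y⁆ v := by
    rw [map_neg, AlternatingMap.neg_apply]
  have e : ∀ Z, φ (Fin.cons Z v : Fin (q + 1) → L) = φ.curryLeft Z v := fun _ => rfl
  cases q with
  | zero =>
    rw [ceFun_cons, ceFun_cons, altLie_cons, altLie_cons, ceFun_cons_zero, ceFun_cons_zero, hs,
      e, e, hn]
    abel
  | succ q =>
    have h2 : ceFun q ((φ.curryLeft X).curryLeft Y) v + ceFun q ((φ.curryLeft Y).curryLeft X) v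
        = 0 := by
      have h3 : (φ.curryLeft X).curryLeft Y + (φ.curryLeft Y).curryLeft X = 0 := by
        have := φ.curryLeft_same (X + Y)
        simp only [map_add, AlternatingMap.curryLeft_add, LinearMap.add_apply,
          AlternatingMap.curryLeft_same, zero_add, add_zero] at this
        rw [add_comm]; exact this
      rw [← ceFun_alt_add, h3, ceFun_alt_zero]
    rw [ceFun_cons, altLie_cons, ceFun_cons, ceFun_cons, altLie_cons, ceFun_cons, hs,
      e, e, hn]
    rw [eq_neg_of_add_eq_zero_left h2]
    abel

theorem ceFun_eq_zero_of_eq (q : ℕ) (φ : L [⋀^Fin q]→ₗ[F] N) (v : Fin (q + 1) → L)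
    (i j : Fin (q + 1)) (hv : v i = v j) (hij : i ≠ j) : ceFun q φ v = 0 := by
  induction q with
  | zero => exact absurd ((Fin.fin_one_eq_zero i).trans (Fin.fin_one_eq_zero j).symm) hij
  | succ q ih =>
    have tailCase : ∀ (v : Fin (q + 2) → L) (i j : Fin (q + 1)), v i.succ = v j.succ → i ≠ j →
        ceFun (q + 1) φ v = 0 := by
      intro v i j hv hij
      obtain ⟨X, w, rfl⟩ := exists_cons v
      simp only [Fin.cons_succ] at hv
      rw [ceFun_cons, AlternatingMap.map_eq_zero_of_eq _ _ hv hij, ih _ _ _ _ hv hij, sub_zero]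
    have headCase : ∀ (v : Fin (q + 2) → L) (j : Fin (q + 1)), v 0 = v j.succ →
        ceFun (q + 1) φ v = 0 := by
      intro v j hv
      obtain ⟨X, w, rfl⟩ := exists_cons v
      obtain ⟨Y, w, rfl⟩ := exists_cons w
      refine Fin.cases (fun hv => ?_) (fun j hv => ?_) j hv
      · simp only [Fin.cons_zero, Fin.cons_succ] at hv
        subst hv
        rw [ceFun_cons]
        cases q with
        | zero =>
          rw [altLie_cons, ceFun_cons_zero, lie_self]
          simp only [sub_sub_cancel_left, neg_eq_zero]
          exact φ.map_coord_zero 0 (by simp)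
        | succ q =>
          rw [altLie_cons, ceFun_cons, lie_self, AlternatingMap.curryLeft_same,
            φ.map_coord_zero 0 (by simp)]
          simp [ceFun_alt_zero]
      · have h := ceFun_swap q φ X Y w
        rw [tailCase (Fin.cons Y (Fin.cons X w : Fin (q + 1) → L)) 0 j.succ (by simpa using hv)
          (by simp [Fin.ext_iff]), add_zero] at h
        exact h
    revert hv hij
    refine Fin.cases ?_ (fun i => ?_) i <;> refine Fin.cases ?_ (fun j => ?_) j
    · intro _ h; exact absurd rfl h
    · intro hv _; exact headCase v j hv
    · intro hv _; exact headCase v i hv.symm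
    · intro hv hij; exact tailCase v i j hv (fun h => hij (by rw [h]))

/-- The Chevalley-Eilenberg differential on alternating forms with values in an `L`-module. -/
def altD (q : ℕ) : (L [⋀^Fin q]→ₗ[F] N) →ₗ[F] (L [⋀^Fin (q + 1)]→ₗ[F] N) where
  toFun φ :=
    { toFun := ceFun q φ
      map_update_add' := by
        intro _ v i x y
        convert ceFun_update_add q φ v i x y
      map_update_smul' := by
        intro _ v i c x
        convert ceFun_update_smul q φ v i c x
      map_eq_zero_of_eq' := fun v i j => ceFun_eq_zero_of_eq q φ v i j }
  map_add' φ ψ := by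
    ext v
    exact ceFun_add q φ ψ v
  map_smul' c φ := by
    ext v
    exact ceFun_smul q c φ v

theorem altD_apply (q : ℕ) (φ : L [⋀^Fin q]→ₗ[F] N) (v : Fin (q + 1) → L) :
    altD q φ v = ceFun q φ v := rfl

theorem curryLeft_altD_zero (φ : L [⋀^Fin 0]→ₗ[F] N) (X : L) :
    (altD 0 φ).curryLeft X = altLie X φ := by
  ext v
  exact ceFun_cons_zero φ X v

theorem curryLeft_altD (q : ℕ) (φ : L [⋀^Fin (q + 1)]→ₗ[F] N) (X : L) :
    (altD (q + 1) φ).curryLeft X = altLie X φ - altD q (φ.curryLeft X) := by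
  ext v
  exact ceFun_cons q φ X v

theorem curryLeft_altLie {q : ℕ} (X Z : L) (ψ : L [⋀^Fin (q + 1)]→ₗ[F] N) :
    (altLie X ψ).curryLeft Z = altLie X (ψ.curryLeft Z) - ψ.curryLeft ⁅X, Z⁆ := by
  ext v
  exact altLie_cons X Z ψ v

theorem ext_curryLeft {q : ℕ} {φ ψ : L [⋀^Fin (q + 1)]→ₗ[F] N}
    (h : ∀ X, φ.curryLeft X = ψ.curryLeft X) : φ = ψ := by
  ext v
  obtain ⟨Z, w, rfl⟩ := exists_cons v
  exact congrArg (fun f => f w) (h Z)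

theorem altD_altLie (q : ℕ) (X : L) (φ : L [⋀^Fin q]→ₗ[F] N) :
    altD q (altLie X φ) = altLie X (altD q φ) := by
  induction q with
  | zero =>
    refine ext_curryLeft fun Y => ?_
    rw [curryLeft_altD_zero, curryLeft_altLie, curryLeft_altD_zero, curryLeft_altD_zero,
      altLie_lie]
    abel
  | succ q ih =>
    refine ext_curryLeft fun Y => ?_
    rw [curryLeft_altD, curryLeft_altLie, curryLeft_altLie, curryLeft_altD, curryLeft_altD,
      altLie_lie, map_sub, map_sub, ih]
    abel

theorem altD_altD (q : ℕ) (φ : L [⋀^Fin q]→ₗ[F] N) : altD (q + 1) (altD q φ) = 0 := by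
  induction q with
  | zero =>
    refine ext_curryLeft fun X => ?_
    rw [curryLeft_altD, curryLeft_altD_zero, altD_altLie, sub_self]
    simp
  | succ q ih =>
    refine ext_curryLeft fun X => ?_
    rw [curryLeft_altD, curryLeft_altD, map_sub, altD_altLie, ih]
    simp

end ChevalleyEilenberg


section NaturalizedAlgebra

attribute [local instance 100] LieRing.ofAssociativeRing

variable {F : Type u} [Field F] {L : Type u} [LieRing L] [LieAlgebra F L]
  {R : Type u} [CommRing R] [Algebra F R]

theorem envelopingAlgebra_induction {P : UniversalEnvelopingAlgebra F L → Prop}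
    (halg : ∀ c : F, P (algebraMap F _ c))
    (hι : ∀ X : L, P (UniversalEnvelopingAlgebra.ι F X))
    (hadd : ∀ u v, P u → P v → P (u + v)) (hmul : ∀ u v, P u → P v → P (u * v))
    (u : UniversalEnvelopingAlgebra F L) : P u := by
  let S : Subalgebra F (UniversalEnvelopingAlgebra F L) :=
    { carrier := {u | P u}
      mul_mem' := fun {a b} ha hb => hmul a b ha hb
      add_mem' := fun {a b} ha hb => hadd a b ha hb
      algebraMap_mem' := halg }
  let i : L →ₗ⁅F⁆ S :=
    { toFun := fun X => ⟨UniversalEnvelopingAlgebra.ι F X, hι X⟩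
      map_add' := fun X Y => Subtype.ext (map_add _ X Y)
      map_smul' := fun c X => Subtype.ext (map_smul _ c X)
      map_lie' := fun {X Y} => Subtype.ext (LieHom.map_lie _ X Y) }
  have h : S.val.comp (UniversalEnvelopingAlgebra.lift F i) = AlgHom.id F _ := by
    apply UniversalEnvelopingAlgebra.hom_ext
    ext X
    simp only [LieHom.coe_comp, Function.comp_apply, AlgHom.coe_toLieHom, AlgHom.coe_comp,
      UniversalEnvelopingAlgebra.lift_ι_apply]
    rfl
  have h2 : u = S.val (UniversalEnvelopingAlgebra.lift F i u) := by
    conv_lhs => rw [← AlgHom.id_apply (R := F) u, ← h]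
    rfl
  rw [h2]
  exact (UniversalEnvelopingAlgebra.lift F i u).2

/-- The naturalized algebra `R ♮ U(L)` (the smash product) of a commutative algebra `R` on which
the Lie algebra `L` acts by derivations through `δ`. Its underlying vector space is `R ⊗ U(L)`. -/
def NatAlg (_δ : L →ₗ⁅F⁆ Derivation F R R) : Type u := R ⊗[F] UniversalEnvelopingAlgebra F L

variable (δ : L →ₗ⁅F⁆ Derivation F R R)

instance : AddCommGroup (NatAlg δ) :=
  inferInstanceAs (AddCommGroup (R ⊗[F] UniversalEnvelopingAlgebra F L))

instance : Module F (NatAlg δ) :=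
  inferInstanceAs (Module F (R ⊗[F] UniversalEnvelopingAlgebra F L))

namespace NatAlg

/-- Left multiplication by `X ∈ L`: `a ⊗ u ↦ X(a) ⊗ u + a ⊗ X u`, i.e. `X a = a X + X(a)`. -/
def leftL : L →ₗ⁅F⁆ Module.End F (R ⊗[F] UniversalEnvelopingAlgebra F L) where
  toFun X := LinearMap.rTensor _ (δ X : R →ₗ[F] R) +
    LinearMap.lTensor R (LinearMap.mulLeft F (UniversalEnvelopingAlgebra.ι F X))
  map_add' X Y := by
    ext a u
    simp [TensorProduct.tmul_add, add_mul]
    abel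
  map_smul' c X := by
    ext a u
    simp [TensorProduct.smul_tmul']
  map_lie' {X Y} := by
    ext a u
    simp [LieRing.of_associative_ring_bracket, TensorProduct.tmul_sub, sub_mul, mul_assoc]
    abel

/-- Left multiplication by `u ∈ U(L)`. -/
def leftU : UniversalEnvelopingAlgebra F L →ₐ[F]
    Module.End F (R ⊗[F] UniversalEnvelopingAlgebra F L) :=
  UniversalEnvelopingAlgebra.lift F (leftL δ)

/-- Left multiplication by `a ∈ R`: `b ⊗ u ↦ a b ⊗ u`. -/
def leftR : R →ₐ[F] Module.End F (R ⊗[F] UniversalEnvelopingAlgebra F L) :=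
  AlgHom.ofLinearMap
    ((LinearMap.rTensorHom _).comp (LinearMap.mul F R))
    (by ext; simp) (by intro x y; ext; simp [mul_assoc])

/-- Left multiplication by `a ⊗ u` is left multiplication by `u` followed by that by `a`. -/
def leftMul : R ⊗[F] UniversalEnvelopingAlgebra F L →ₗ[F]
    Module.End F (R ⊗[F] UniversalEnvelopingAlgebra F L) :=
  TensorProduct.lift ((LinearMap.mul F _).compl₁₂ (leftR (F := F) (L := L) (R := R)).toLinearMap
    (leftU δ).toLinearMap)

theorem leftMul_tmul (a : R) (u : UniversalEnvelopingAlgebra F L) :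
    leftMul δ (a ⊗ₜ u) = leftR a * leftU δ u := rfl

@[simp] theorem leftR_tmul (a b : R) (v : UniversalEnvelopingAlgebra F L) :
    leftR (F := F) a (b ⊗ₜ v) = (a * b) ⊗ₜ v := rfl

@[simp] theorem leftU_ι_tmul (X : L) (b : R) (v : UniversalEnvelopingAlgebra F L) :
    leftU δ (UniversalEnvelopingAlgebra.ι F X) (b ⊗ₜ v) =
      (δ X b) ⊗ₜ v + b ⊗ₜ (UniversalEnvelopingAlgebra.ι F X * v) := by
  rw [leftU, UniversalEnvelopingAlgebra.lift_ι_apply]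
  rfl

theorem leftU_one_tmul (u v : UniversalEnvelopingAlgebra F L) :
    leftU δ u ((1 : R) ⊗ₜ v) = (1 : R) ⊗ₜ (u * v) := by
  induction u using envelopingAlgebra_induction generalizing v with
  | halg c => simp [Algebra.algebraMap_eq_smul_one]
  | hι X => rw [leftU_ι_tmul, Derivation.map_one_eq_zero, TensorProduct.zero_tmul, zero_add]
  | hadd u₁ u₂ h₁ h₂ => simp [h₁, h₂, add_mul, TensorProduct.tmul_add]
  | hmul u₁ u₂ h₁ h₂ => simp [h₁, h₂, mul_assoc]

theorem leftMul_leftR (a : R) (z : R ⊗[F] UniversalEnvelopingAlgebra F L) :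
    leftMul δ (leftR a z) = leftR a * leftMul δ z := by
  induction z with
  | zero => simp
  | add x y hx hy => simp [hx, hy, mul_add]
  | tmul b v => rw [leftR_tmul, leftMul_tmul, leftMul_tmul, map_mul, mul_assoc]

theorem leftU_ι_leftR (X : L) (b : R) :
    leftU δ (UniversalEnvelopingAlgebra.ι F X) * leftR b =
      leftR (δ X b) + leftR b * leftU δ (UniversalEnvelopingAlgebra.ι F X) := by
  refine TensorProduct.ext' fun c v => ?_
  simp only [Module.End.mul_apply, LinearMap.add_apply, leftR_tmul, leftU_ι_tmul, map_add,
    Derivation.leibniz, smul_eq_mul, TensorProduct.add_tmul]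
  rw [mul_comm c]
  abel

theorem leftMul_leftU (u : UniversalEnvelopingAlgebra F L)
    (z : R ⊗[F] UniversalEnvelopingAlgebra F L) :
    leftMul δ (leftU δ u z) = leftU δ u * leftMul δ z := by
  induction u using envelopingAlgebra_induction generalizing z with
  | halg c => simp [Algebra.algebraMap_eq_smul_one]
  | hι X =>
    induction z with
    | zero => simp
    | add x y hx hy => rw [map_add, map_add, map_add, hx, hy, mul_add]
    | tmul b v =>
      rw [leftU_ι_tmul, map_add, leftMul_tmul, leftMul_tmul, leftMul_tmul, map_mul, ← mul_assoc,
        ← mul_assoc, leftU_ι_leftR, add_mul]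
  | hadd u₁ u₂ h₁ h₂ => simp [h₁, h₂, add_mul]
  | hmul u₁ u₂ h₁ h₂ => simp [h₁, h₂, mul_assoc]

theorem leftMul_leftMul (x y : R ⊗[F] UniversalEnvelopingAlgebra F L) :
    leftMul δ (leftMul δ x y) = leftMul δ x * leftMul δ y := by
  induction x with
  | zero => simp
  | add x₁ x₂ h₁ h₂ => simp [h₁, h₂, add_mul]
  | tmul a u =>
    rw [leftMul_tmul, Module.End.mul_apply, leftMul_leftR, leftMul_leftU, mul_assoc]

theorem leftMul_one : leftMul δ ((1 : R) ⊗ₜ[F] 1) = 1 := by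
  rw [leftMul_tmul, map_one, map_one, mul_one]

theorem leftMul_apply_one (x : R ⊗[F] UniversalEnvelopingAlgebra F L) :
    leftMul δ x ((1 : R) ⊗ₜ[F] 1) = x := by
  induction x with
  | zero => simp
  | add x₁ x₂ h₁ h₂ => simp [h₁, h₂]
  | tmul a u => rw [leftMul_tmul, Module.End.mul_apply, leftU_one_tmul, leftR_tmul, mul_one,
      mul_one]

instance : Ring (NatAlg δ) where
  __ := (inferInstance : AddCommGroup (NatAlg δ))
  mul x y := leftMul δ x y
  one := (1 : R) ⊗ₜ[F] (1 : UniversalEnvelopingAlgebra F L)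
  left_distrib x y z := map_add (leftMul δ x) y z
  right_distrib x y z := LinearMap.congr_fun (map_add (leftMul δ) x y) z
  zero_mul x := LinearMap.congr_fun (map_zero (leftMul δ)) x
  mul_zero x := map_zero (leftMul δ x)
  mul_assoc x y z := LinearMap.congr_fun (leftMul_leftMul δ x y) z
  one_mul x := LinearMap.congr_fun (leftMul_one δ) x
  mul_one x := leftMul_apply_one δ x

instance : Algebra F (NatAlg δ) :=
  Algebra.ofModule (fun c x y => LinearMap.congr_fun (map_smul (leftMul δ) c x) y)
    (fun c x y => map_smul (leftMul δ x) c y)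

theorem mul_def (x y : NatAlg δ) : x * y = leftMul δ x y := rfl

/-- The embedding `R → R ♮ U(L)`, `a ↦ a ⊗ 1`. -/
def ofR : R →ₐ[F] NatAlg δ :=
  AlgHom.ofLinearMap
    (show R →ₗ[F] R ⊗[F] UniversalEnvelopingAlgebra F L from
      (TensorProduct.mk F R (UniversalEnvelopingAlgebra F L)).flip 1) rfl
    (by
      intro a b
      change (a * b) ⊗ₜ[F] (1 : UniversalEnvelopingAlgebra F L) =
        leftMul δ (a ⊗ₜ[F] 1) (b ⊗ₜ[F] 1)
      rw [leftMul_tmul, map_one, mul_one, leftR_tmul])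

/-- The embedding `U(L) → R ♮ U(L)`, `u ↦ 1 ⊗ u`. -/
def ofU : UniversalEnvelopingAlgebra F L →ₐ[F] NatAlg δ :=
  AlgHom.ofLinearMap
    (show UniversalEnvelopingAlgebra F L →ₗ[F] R ⊗[F] UniversalEnvelopingAlgebra F L from
      TensorProduct.mk F R (UniversalEnvelopingAlgebra F L) 1) rfl
    (by
      intro u v
      change (1 : R) ⊗ₜ[F] (u * v) = leftMul δ ((1 : R) ⊗ₜ[F] u) ((1 : R) ⊗ₜ[F] v)
      rw [leftMul_tmul, map_one, one_mul, leftU_one_tmul])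

/-- The composite `L → U(L) → R ♮ U(L)`. -/
def ofL : L →ₗ[F] NatAlg δ :=
  (ofU δ).toLinearMap ∘ₗ (UniversalEnvelopingAlgebra.ι F : L →ₗ⁅F⁆ _).toLinearMap

theorem ofR_mul_ofU (a : R) (u : UniversalEnvelopingAlgebra F L) :
    ofR δ a * ofU δ u = (a ⊗ₜ[F] u : R ⊗[F] UniversalEnvelopingAlgebra F L) := by
  change leftMul δ (a ⊗ₜ[F] 1) ((1 : R) ⊗ₜ[F] u) = _
  rw [leftMul_tmul, map_one, mul_one, leftR_tmul, mul_one]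

/-- The defining relation `[X, f] = X(f)`. -/
theorem ofL_mul_ofR (X : L) (f : R) :
    ofL δ X * ofR δ f - ofR δ f * ofL δ X = ofR δ (δ X f) := by
  rw [sub_eq_iff_eq_add]
  have h1 : ofL δ X * ofR δ f = leftMul δ
    ((1 : R) ⊗ₜ[F] UniversalEnvelopingAlgebra.ι F X) (f ⊗ₜ[F] 1) := rfl
  have h2 : ofR δ f * ofL δ X = _ := ofR_mul_ofU δ f (UniversalEnvelopingAlgebra.ι F X)
  rw [h1, h2, leftMul_tmul, map_one, one_mul, leftU_ι_tmul, mul_one]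
  rfl

theorem ofL_lie (X Y : L) : ofL δ ⁅X, Y⁆ = ofL δ X * ofL δ Y - ofL δ Y * ofL δ X := by
  have h : ∀ Z, ofL δ Z = ofU δ (UniversalEnvelopingAlgebra.ι F Z) := fun _ => rfl
  rw [h, h, h, LieHom.map_lie, LieRing.of_associative_ring_bracket, map_sub, map_mul, map_mul]

variable {E : Type u} [Ring E] [Algebra F E]

/-- Compatible actions of `R` and of `L` amount to an action of `R ♮ U(L)`. -/
def lift (f : R →ₐ[F] E) (g : L →ₗ[F] E) (hg : ∀ X Y, g ⁅X, Y⁆ = g X * g Y - g Y * g X)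
    (hfg : ∀ X a, g X * f a - f a * g X = f (δ X a)) : NatAlg δ →ₐ[F] E :=
  let G : UniversalEnvelopingAlgebra F L →ₐ[F] E :=
    UniversalEnvelopingAlgebra.lift F { g with map_lie' := fun {X Y} => hg X Y }
  let Φ : R ⊗[F] UniversalEnvelopingAlgebra F L →ₗ[F] E :=
    TensorProduct.lift ((LinearMap.mul F E).compl₁₂ f.toLinearMap G.toLinearMap)
  have hΦ : ∀ a u, Φ (a ⊗ₜ u) = f a * G u := fun _ _ => rfl
  have hG : ∀ X, G (UniversalEnvelopingAlgebra.ι F X) = g X := fun X =>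
    UniversalEnvelopingAlgebra.lift_ι_apply F _ X
  have hU : ∀ u z, Φ (leftU δ u z) = G u * Φ z := by
    intro u
    induction u using envelopingAlgebra_induction with
    | halg c => intro z; simp [Algebra.algebraMap_eq_smul_one]
    | hι X =>
      intro z
      induction z with
      | zero => simp
      | add x y hx hy => rw [map_add, map_add, map_add, hx, hy, mul_add]
      | tmul b v =>
        rw [leftU_ι_tmul, map_add, hΦ, hΦ, hΦ, map_mul, hG, ← hfg X b, ← mul_assoc, ← mul_assoc,
          ← add_mul, sub_add_cancel]
    | hadd u₁ u₂ h₁ h₂ => intro z; simp [h₁, h₂, add_mul]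
    | hmul u₁ u₂ h₁ h₂ => intro z; simp [h₁, h₂, mul_assoc]
  have hR : ∀ a z, Φ (leftR a z) = f a * Φ z := by
    intro a z
    induction z with
    | zero => simp
    | add x y hx hy => simp [hx, hy, mul_add]
    | tmul b v => rw [leftR_tmul, hΦ, hΦ, map_mul, mul_assoc]
  have hM : ∀ x y, Φ (leftMul δ x y) = Φ x * Φ y := by
    intro x y
    induction x with
    | zero => simp
    | add x₁ x₂ h₁ h₂ => rw [map_add, LinearMap.add_apply, map_add, h₁, h₂, map_add, add_mul]
    | tmul a u => rw [leftMul_tmul, Module.End.mul_apply, hR, hU, hΦ, mul_assoc]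
  AlgHom.ofLinearMap (A := NatAlg δ) Φ
    (by
      change Φ ((1 : R) ⊗ₜ[F] 1) = 1
      rw [hΦ, map_one, map_one, mul_one]) hM

theorem lift_ofR (f : R →ₐ[F] E) (g : L →ₗ[F] E) (hg) (hfg) (a : R) :
    lift δ f g hg hfg (ofR δ a) = f a := by
  change f a * (UniversalEnvelopingAlgebra.lift F _) 1 = f a
  rw [map_one, mul_one]

theorem lift_ofL (f : R →ₐ[F] E) (g : L →ₗ[F] E) (hg) (hfg) (X : L) :
    lift δ f g hg hfg (ofL δ X) = g X := by
  change f 1 * (UniversalEnvelopingAlgebra.lift F _) (UniversalEnvelopingAlgebra.ι F X) = g X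
  rw [map_one, one_mul, UniversalEnvelopingAlgebra.lift_ι_apply]
  rfl

end NatAlg

end NaturalizedAlgebra

section GRModules

variable (F : Type u) [Field F] (L : Type u) [LieRing L] [LieAlgebra F L]
  (R : Type u) [CommRing R] [Algebra F R]

/-- Relations on the free algebra on `R ⊕ L` whose modules are the vector spaces with an action of
the algebra `R` and an action of the Lie algebra `L`, with no compatibility between them. -/
inductive GRRel : FreeAlgebra F (R ⊕ L) → FreeAlgebra F (R ⊕ L) → Prop
  | addR (a b : R) : GRRel (FreeAlgebra.ι F (.inl (a + b)))
      (FreeAlgebra.ι F (.inl a) + FreeAlgebra.ι F (.inl b))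
  | mulR (a b : R) : GRRel (FreeAlgebra.ι F (.inl (a * b)))
      (FreeAlgebra.ι F (.inl a) * FreeAlgebra.ι F (.inl b))
  | algR (c : F) : GRRel (FreeAlgebra.ι F (.inl (algebraMap F R c))) (algebraMap F _ c)
  | addL (X Y : L) : GRRel (FreeAlgebra.ι F (.inr (X + Y)))
      (FreeAlgebra.ι F (.inr X) + FreeAlgebra.ι F (.inr Y))
  | smulL (c : F) (X : L) : GRRel (FreeAlgebra.ι F (.inr (c • X))) (c • FreeAlgebra.ι F (.inr X))
  | lieL (X Y : L) : GRRel (FreeAlgebra.ι F (.inr ⁅X, Y⁆))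
      (FreeAlgebra.ι F (.inr X) * FreeAlgebra.ι F (.inr Y) -
        FreeAlgebra.ι F (.inr Y) * FreeAlgebra.ι F (.inr X))

/-- The free product of the algebras `R` and `U(L)`. -/
def GRAlg : Type u := RingQuot (GRRel F L R)

instance : Ring (GRAlg F L R) := inferInstanceAs (Ring (RingQuot (GRRel F L R)))

instance : Algebra F (GRAlg F L R) := inferInstanceAs (Algebra F (RingQuot (GRRel F L R)))

/-- The category of `(L, R)`-modules: vector spaces with an action of `L` and an action of `R`,
not required to be compatible with each other. -/
abbrev GRMod := ModuleCat.{u} (GRAlg F L R)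

namespace GRAlg

variable {F L R}

/-- The quotient map from the free algebra. -/
def mk : FreeAlgebra F (R ⊕ L) →ₐ[F] GRAlg F L R := RingQuot.mkAlgHom F (GRRel F L R)

theorem mk_rel {x y : FreeAlgebra F (R ⊕ L)} (h : GRRel F L R x y) :
    (mk x : GRAlg F L R) = mk y := RingQuot.mkAlgHom_rel F h

variable (F L R) in
/-- The map from `R`. -/
def ofR : R →ₐ[F] GRAlg F L R where
  toFun a := mk (FreeAlgebra.ι F (.inl a))
  map_one' := by
    have := mk_rel (.algR (F := F) (L := L) (R := R) 1)
    simpa using this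
  map_zero' := by
    have := mk_rel (.algR (F := F) (L := L) (R := R) 0)
    simpa using this
  map_add' a b := by simpa using mk_rel (.addR (F := F) (L := L) (R := R) a b)
  map_mul' a b := by simpa using mk_rel (.mulR (F := F) (L := L) (R := R) a b)
  commutes' c := by simpa using mk_rel (.algR (F := F) (L := L) (R := R) c)

variable (F L R) in
/-- The map from `L`. -/
def ofL : L →ₗ[F] GRAlg F L R where
  toFun X := mk (FreeAlgebra.ι F (.inr X))
  map_add' X Y := by simpa using mk_rel (.addL (F := F) (L := L) (R := R) X Y)
  map_smul' c X := by simpa using mk_rel (.smulL (F := F) (L := L) (R := R) c X)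

theorem ofL_lie (X Y : L) : ofL F L R ⁅X, Y⁆ =
    ofL F L R X * ofL F L R Y - ofL F L R Y * ofL F L R X := by
  change mk (FreeAlgebra.ι F (Sum.inr ⁅X, Y⁆)) =
    mk (FreeAlgebra.ι F (Sum.inr X)) * mk (FreeAlgebra.ι F (Sum.inr Y)) -
      mk (FreeAlgebra.ι F (Sum.inr Y)) * mk (FreeAlgebra.ι F (Sum.inr X))
  simpa using mk_rel (.lieL (F := F) (L := L) (R := R) X Y)

variable {E : Type u} [Ring E] [Algebra F E]

/-- The universal property. -/
def lift (f : R →ₐ[F] E) (g : L →ₗ[F] E) (hg : ∀ X Y, g ⁅X, Y⁆ = g X * g Y - g Y * g X) :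
    GRAlg F L R →ₐ[F] E :=
  RingQuot.liftAlgHom F ⟨FreeAlgebra.lift F (Sum.elim f g), by
    intro x y h
    induction h <;> simp [hg]⟩

theorem lift_ofR (f : R →ₐ[F] E) (g : L →ₗ[F] E) (hg) (a : R) :
    lift f g hg (ofR F L R a) = f a := by
  change RingQuot.liftAlgHom F _ (RingQuot.mkAlgHom F (GRRel F L R) _) = _
  rw [RingQuot.liftAlgHom_mkAlgHom_apply]
  simp

theorem lift_ofL (f : R →ₐ[F] E) (g : L →ₗ[F] E) (hg) (X : L) :
    lift f g hg (ofL F L R X) = g X := by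
  change RingQuot.liftAlgHom F _ (RingQuot.mkAlgHom F (GRRel F L R) _) = _
  rw [RingQuot.liftAlgHom_mkAlgHom_apply]
  simp

theorem induction {P : GRAlg F L R → Prop} (halg : ∀ c : F, P (algebraMap F _ c))
    (hR : ∀ a, P (ofR F L R a)) (hL : ∀ X, P (ofL F L R X))
    (hadd : ∀ u v, P u → P v → P (u + v)) (hmul : ∀ u v, P u → P v → P (u * v))
    (x : GRAlg F L R) : P x := by
  obtain ⟨y, rfl⟩ : ∃ y, mk y = x := RingQuot.mkAlgHom_surjective F (GRRel F L R) x
  induction y using FreeAlgebra.induction with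
  | grade0 c => rw [AlgHom.commutes]; exact halg c
  | grade1 z =>
    cases z with
    | inl a => exact hR a
    | inr X => exact hL X
  | mul a b ha hb => rw [map_mul]; exact hmul _ _ ha hb
  | add a b ha hb => rw [map_add]; exact hadd _ _ ha hb

end GRAlg

namespace GRMod

variable {F L R}
variable (ω : R →ₐ[F] F)
  {V W : Type u} [AddCommGroup V] [Module F V] [AddCommGroup W] [Module F W]

/-- The algebra map `GRAlg → End V` attached to an action `ρ` of `L` on `V` and to the action of
`R` on `V` through the algebra homomorphism `ω : R → F`. -/
def unityAction (ρ : L →ₗ[F] Module.End F V)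
    (hρ : ∀ X Y, ρ ⁅X, Y⁆ = ρ X * ρ Y - ρ Y * ρ X) : GRAlg F L R →ₐ[F] Module.End F V :=
  GRAlg.lift ((Algebra.ofId F (Module.End F V)).comp ω) ρ hρ

/-- The `(L, R)`-module `V` on which `L` acts by `ρ` and `f ∈ R` acts as the scalar `ω(f)`. -/
def ofUnity (ρ : L →ₗ[F] Module.End F V)
    (hρ : ∀ X Y, ρ ⁅X, Y⁆ = ρ X * ρ Y - ρ Y * ρ X) : GRMod F L R :=
  letI := Module.compHom V (unityAction ω ρ hρ).toRingHom
  ModuleCat.of (GRAlg F L R) V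

variable {ω} {ρ : L →ₗ[F] Module.End F V} {hρ : ∀ X Y, ρ ⁅X, Y⁆ = ρ X * ρ Y - ρ Y * ρ X}
  {ρ' : L →ₗ[F] Module.End F W} {hρ' : ∀ X Y, ρ' ⁅X, Y⁆ = ρ' X * ρ' Y - ρ' Y * ρ' X}

/-- A linear map commuting with the actions of `L` is a morphism of `(L, R)`-modules (both with
the action of `R` through `ω`). -/
def homUnity (f : V →ₗ[F] W) (hf : ∀ X v, f (ρ X v) = ρ' X (f v)) :
    ofUnity ω ρ hρ ⟶ ofUnity ω ρ' hρ' :=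
  letI := Module.compHom V (unityAction ω ρ hρ).toRingHom
  letI := Module.compHom W (unityAction ω ρ' hρ').toRingHom
  ModuleCat.ofHom (R := GRAlg F L R)
    { toFun := f
      map_add' := f.map_add
      map_smul' := by
        intro x
        change ∀ v : V, f (unityAction ω ρ hρ x v) = unityAction ω ρ' hρ' x (f v)
        induction x using GRAlg.induction with
        | halg c => simp
        | hR a => simp [unityAction, GRAlg.lift_ofR, Algebra.ofId_apply]
        | hL X => simpa [unityAction, GRAlg.lift_ofL] using hf X
        | hadd a b ha hb => simp [ha, hb]
        | hmul a b ha hb => simp [ha, hb] }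

theorem homUnity_apply (f : V →ₗ[F] W) (hf : ∀ X v, f (ρ X v) = ρ' X (f v)) (v : V) :
    (homUnity (ω := ω) (hρ := hρ) (hρ' := hρ') f hf).hom v = f v := rfl

theorem hom_ext' {f g : ofUnity ω ρ hρ ⟶ ofUnity ω ρ' hρ'}
    (h : ∀ v : V, f.hom v = g.hom v) : f = g := by
  ext v
  exact h v

variable (F L R)

/-- The forgetful functor from `(L, R)`-modules to `R`-modules. -/
abbrev toRMod : GRMod F L R ⥤ ModuleCat.{u} R :=
  ModuleCat.restrictScalars (GRAlg.ofR F L R).toRingHom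

end GRMod

end GRModules


section Category

variable {F : Type u} [Field F] {L : Type u} [LieRing L] [LieAlgebra F L]
  {R : Type u} [CommRing R] [Algebra F R] (δ : L →ₗ⁅F⁆ Derivation F R R)

/-- The category of universal Lie-Cartan modules, as modules over `R ♮ U(L)`. -/
abbrev ULC := ModuleCat.{u} (NatAlg δ)

open scoped ModuleCat

variable {δ}

/-- The action `θ` of `R` on a universal Lie-Cartan module. -/
instance (M : ULC δ) : Module R M := Module.compHom M (NatAlg.ofR δ).toRingHom

/-- The action `ρ` of `L` on a universal Lie-Cartan module. -/
instance (M : ULC δ) : LieRingModule L M where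
  bracket X m := NatAlg.ofL δ X • m
  add_lie X Y m := by
    rw [map_add, add_smul]
  lie_add X m m' := smul_add (NatAlg.ofL δ X) m m'
  leibniz_lie X Y m := by
    change NatAlg.ofL δ X • NatAlg.ofL δ Y • m =
      NatAlg.ofL δ ⁅X, Y⁆ • m + NatAlg.ofL δ Y • NatAlg.ofL δ X • m
    rw [NatAlg.ofL_lie, sub_smul, mul_smul, mul_smul, sub_add_cancel]

theorem r_smul_def (M : ULC δ) (f : R) (m : M) : f • m = NatAlg.ofR δ f • m := rfl

theorem lie_def (M : ULC δ) (X : L) (m : M) : ⁅X, m⁆ = NatAlg.ofL δ X • m := rfl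

instance (M : ULC δ) : LieModule F L M where
  smul_lie c X m := by rw [lie_def, lie_def, map_smul, smul_assoc]
  lie_smul c X m := by
    rw [lie_def, lie_def, algebra_compatible_smul (NatAlg δ) c m,
      algebra_compatible_smul (NatAlg δ) c (NatAlg.ofL δ X • m), smul_smul, smul_smul,
      Algebra.commutes]

instance (M : ULC δ) : IsScalarTower F R M where
  smul_assoc c f m := by rw [r_smul_def, r_smul_def, map_smul, smul_assoc]

/-- The compatibility `[ρ(X), θ(f)] = θ(X(f))` holds in every universal Lie-Cartan module. -/
theorem lie_r_smul (M : ULC δ) (X : L) (f : R) (m : M) :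
    ⁅X, f • m⁆ - f • ⁅X, m⁆ = δ X f • m := by
  simp only [r_smul_def, lie_def, ← NatAlg.ofL_mul_ofR, sub_smul, mul_smul]

theorem hom_r_smul {M N : ULC δ} (φ : M ⟶ N) (f : R) (m : M) :
    φ.hom (f • m) = f • φ.hom m := φ.hom.map_smul _ _

theorem hom_lie {M N : ULC δ} (φ : M ⟶ N) (X : L) (m : M) :
    φ.hom ⁅X, m⁆ = ⁅X, φ.hom m⁆ := φ.hom.map_smul _ _

theorem hom_f_smul {M N : ULC δ} (φ : M ⟶ N) (c : F) (m : M) :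
    φ.hom (c • m) = c • φ.hom m := by
  rw [algebra_compatible_smul (NatAlg δ), map_smul, ← algebra_compatible_smul (NatAlg δ)]

/-- A morphism, as a map of `R`-modules. -/
def homR {M N : ULC δ} (φ : M ⟶ N) : M →ₗ[R] N where
  toFun := φ.hom
  map_add' := φ.hom.map_add
  map_smul' := hom_r_smul φ

/-- A morphism, as a map of vector spaces. -/
def homF {M N : ULC δ} (φ : M ⟶ N) : M →ₗ[F] N where
  toFun := φ.hom
  map_add' := φ.hom.map_add
  map_smul' := hom_f_smul φ

variable (δ)

/-- A vector space `M` with an action `θ` of `R` and an action `ρ` of `L` satisfying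
`[ρ(X), θ(f)] = θ(X(f))`, as a universal Lie-Cartan module. -/
def ulcOf (M : Type u) [AddCommGroup M] [Module F M] (θ : R →ₐ[F] Module.End F M)
    (ρ : L →ₗ[F] Module.End F M) (hρ : ∀ X Y, ρ ⁅X, Y⁆ = ρ X * ρ Y - ρ Y * ρ X)
    (h : ∀ X f, ρ X * θ f - θ f * ρ X = θ (δ X f)) : ULC δ :=
  letI := Module.compHom M (NatAlg.lift δ θ ρ hρ h).toRingHom
  ModuleCat.of (NatAlg δ) M

theorem ulcOf_smul (M : Type u) [AddCommGroup M] [Module F M] (θ : R →ₐ[F] Module.End F M)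
    (ρ : L →ₗ[F] Module.End F M) (hρ) (h) (f : R) (m : M) :
    (f • (show ulcOf δ M θ ρ hρ h from m) : ulcOf δ M θ ρ hρ h) = θ f m := by
  change (NatAlg.lift δ θ ρ hρ h (NatAlg.ofR δ f)) m = θ f m
  rw [NatAlg.lift_ofR]

theorem ulcOf_lie (M : Type u) [AddCommGroup M] [Module F M] (θ : R →ₐ[F] Module.End F M)
    (ρ : L →ₗ[F] Module.End F M) (hρ) (h) (X : L) (m : M) :
    (⁅X, (show ulcOf δ M θ ρ hρ h from m)⁆ : ulcOf δ M θ ρ hρ h) = ρ X m := by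
  change (NatAlg.lift δ θ ρ hρ h (NatAlg.ofL δ X)) m = ρ X m
  rw [NatAlg.lift_ofL]

variable {δ} in
/-- A map of `R`-modules commuting with the action of `L` is a morphism of universal Lie-Cartan
modules (the converse is `hom_r_smul` and `hom_lie`). -/
def ulcHom {M N : ULC δ} (f : M →ₗ[R] N) (hf : ∀ (X : L) (m : M), f ⁅X, m⁆ = ⁅X, f m⁆) : M ⟶ N :=
  ModuleCat.ofHom
    { toFun := f
      map_add' := f.map_add
      map_smul' := by
        have hU : ∀ u m, f (NatAlg.ofU δ u • m) = NatAlg.ofU δ u • f m := by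
          intro u
          induction u using envelopingAlgebra_induction with
          | halg c =>
            intro m
            rw [AlgHom.commutes, ← AlgHom.commutes (NatAlg.ofR δ) c]
            exact f.map_smul _ m
          | hι X => intro m; exact hf X m
          | hadd u v hu hv => intro m; rw [map_add, add_smul, add_smul, map_add, hu, hv]
          | hmul u v hu hv => intro m; rw [map_mul, mul_smul, mul_smul, hu, hv]
        have hT : ∀ x : R ⊗[F] UniversalEnvelopingAlgebra F L, ∀ m : M,
            f ((show NatAlg δ from x) • m) = (show NatAlg δ from x) • f m := by
          intro x
          induction x with
          | zero =>
            intro m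
            exact (congrArg f (zero_smul (NatAlg δ) m)).trans
              ((map_zero f).trans (zero_smul (NatAlg δ) (f m)).symm)
          | add x y hx hy =>
            intro m
            refine (congrArg f (add_smul (show NatAlg δ from x) (show NatAlg δ from y) m)).trans ?_
            rw [map_add, hx, hy]
            exact (add_smul (show NatAlg δ from x) (show NatAlg δ from y) (f m)).symm
          | tmul a u =>
            intro m
            rw [← NatAlg.ofR_mul_ofU]
            change f ((NatAlg.ofR δ a * NatAlg.ofU δ u) • m) =
              (NatAlg.ofR δ a * NatAlg.ofU δ u) • f m
            rw [mul_smul, mul_smul, ← hU]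
            exact f.map_smul a _
        exact hT }

/-- The algebra `R` as a universal Lie-Cartan module: `R` acts by multiplication and `L` by
derivations. -/
def coord : ULC δ :=
  ulcOf δ R (Algebra.lmul F R)
    { toFun := fun X => (δ X : R →ₗ[F] R)
      map_add' := fun X Y => by simp
      map_smul' := fun c X => by simp }
    (fun X Y => by ext; simp [LieRing.of_associative_ring_bracket])
    (fun X a => by ext; simp [mul_comm])

/-- The functor `Γ = Hom(R, -)` from universal Lie-Cartan modules to `(L, R)`-modules, where `R`
acts on `Γ(M)` through `ω` and `L` acts by `(X φ)(r) = X(φ(r)) - φ(X(r))`, which is `0`. -/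
def homFromR (ω : R →ₐ[F] F) : ULC δ ⥤ GRMod F L R where
  obj M := GRMod.ofUnity ω (V := coord δ ⟶ M) 0 (by simp)
  map f := GRMod.homUnity (Linear.rightComp F (coord δ) f) (by simp)
  map_id M := GRMod.hom_ext' fun v => Category.comp_id v
  map_comp f g := GRMod.hom_ext' fun v => (Category.assoc v f g).symm

theorem homFromR_lie (M : ULC δ) (φ : coord δ ⟶ M) (X : L) (r : coord δ) :
    ⁅X, φ.hom r⁆ - φ.hom ⁅X, r⁆ = 0 := by
  rw [hom_lie, sub_self]

instance (ω : R →ₐ[F] F) : (homFromR δ ω).Additive where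
  map_add {_ _ f g} := GRMod.hom_ext' fun v => Preadditive.comp_add _ _ _ v f g

variable {δ}

/-- The space of cochains `C^q(M) = Hom_R(R ⊗ ⋀^q L, M)`. -/
abbrev Cochain (M : ULC δ) (q : ℕ) : Type u := (R ⊗[F] ⋀[F]^q L) →ₗ[R] M

/-- The identification of `C^q(M)` with alternating forms: `φ ↦ ((v_i) ↦ φ(1 ⊗ v₁ ∧ … ∧ v_q))`. -/
def cochainEquiv (M : ULC δ) (q : ℕ) : (L [⋀^Fin q]→ₗ[F] M) ≃ₗ[F] Cochain M q :=
  (exteriorPower.alternatingMapLinearEquiv (R := F) (M := L) (N := M) (n := q)).trans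
    ((LinearMap.liftBaseChangeEquiv R).restrictScalars F)

theorem cochainEquiv_tmul (M : ULC δ) (q : ℕ) (φ : L [⋀^Fin q]→ₗ[F] M) (r : R) (v : Fin q → L) :
    cochainEquiv M q φ (r ⊗ₜ exteriorPower.ιMulti F q v) = r • φ v := by
  simp [cochainEquiv]

theorem cochainEquiv_symm_apply (M : ULC δ) (q : ℕ) (φ : Cochain M q) (v : Fin q → L) :
    (cochainEquiv M q).symm φ v = φ (1 ⊗ₜ exteriorPower.ιMulti F q v) := by
  obtain ⟨ψ, rfl⟩ := (cochainEquiv M q).surjective φ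
  rw [LinearEquiv.symm_apply_apply, cochainEquiv_tmul, one_smul]

theorem cochain_tmul (M : ULC δ) (q : ℕ) (φ : Cochain M q) (r : R) (w : ⋀[F]^q L) :
    φ (r ⊗ₜ w) = r • φ (1 ⊗ₜ w) := by
  rw [← map_smul, TensorProduct.smul_tmul', smul_eq_mul, mul_one]

/-- The differential `C^q(M) → C^{q+1}(M)`; see `cochainD_tmul_zero` and `cochainD_tmul` for its
values. -/
def cochainD (M : ULC δ) (q : ℕ) : Cochain M q →ₗ[F] Cochain M (q + 1) :=
  (cochainEquiv M (q + 1)).toLinearMap ∘ₗ altD q ∘ₗ (cochainEquiv M q).symm.toLinearMap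

theorem cochainD_tmul_zero (M : ULC δ) (φ : Cochain M 0) (r : R) (v : Fin 1 → L) :
    cochainD M 0 φ (r ⊗ₜ exteriorPower.ιMulti F 1 v) =
      r • ⁅v 0, φ (1 ⊗ₜ exteriorPower.ιMulti F 0 Fin.elim0)⁆ := by
  change cochainEquiv M 1 (altD 0 ((cochainEquiv M 0).symm φ)) _ = _
  rw [cochainEquiv_tmul, altD_apply, ceFun]
  simp only [bracketPart, actionPart, cochainEquiv_symm_apply, zero_add]
  have h : (fun k : Fin 0 => v k.succ) = Fin.elim0 := Subsingleton.elim _ _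
  simp [h]

/-- The formula for the differential of a cochain of degree `q + 1` (indices start at `0`). -/
theorem cochainD_tmul (M : ULC δ) (q : ℕ) (φ : Cochain M (q + 1)) (r : R) (v : Fin (q + 2) → L) :
    cochainD M (q + 1) φ (r ⊗ₜ exteriorPower.ιMulti F (q + 2) v) =
      (∑ t : Fin (q + 2), ∑ s : Fin (q + 1),
        if s.castSucc < t then
          (-1 : ℤ) ^ ((s : ℕ) + (t : ℕ)) •
            φ (r ⊗ₜ exteriorPower.ιMulti F (q + 1)
              (Fin.cons ⁅v s.castSucc, v t⁆ fun k => v (t.succAbove (s.succAbove k))))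
        else 0) +
      ∑ s : Fin (q + 2), (-1 : ℤ) ^ (s : ℕ) •
        r • ⁅v s, φ (1 ⊗ₜ exteriorPower.ιMulti F (q + 1) fun k => v (s.succAbove k))⁆ := by
  change cochainEquiv M (q + 2) (altD (q + 1) ((cochainEquiv M (q + 1)).symm φ)) _ = _
  rw [cochainEquiv_tmul, altD_apply, ceFun]
  simp only [bracketPart, actionPart, cochainEquiv_symm_apply, smul_add, Finset.smul_sum]
  congr 1
  · refine Finset.sum_congr rfl fun t _ => Finset.sum_congr rfl fun s _ => ?_
    split_ifs
    · rw [smul_comm, ← cochain_tmul]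
    · rw [smul_zero]
  · exact Finset.sum_congr rfl fun s _ => smul_comm _ _ _

/-- The action of `L` on `C^q(M)`; see `cochainLie_tmul` for its values. -/
def cochainLie (M : ULC δ) (q : ℕ) : L →ₗ[F] Module.End F (Cochain M q) where
  toFun X := (cochainEquiv M q).toLinearMap ∘ₗ altLie X ∘ₗ (cochainEquiv M q).symm.toLinearMap
  map_add' X Y := by ext1 φ; simp [altLie_add]
  map_smul' c X := by ext1 φ; simp [altLie_smul]

/-- `(X φ)(r ⊗ w) = X(φ(r ⊗ w)) - φ(X(r) ⊗ w) - φ(r ⊗ X.w)`. -/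
theorem cochainLie_tmul (M : ULC δ) (q : ℕ) (X : L) (φ : Cochain M q) (r : R) (v : Fin q → L) :
    cochainLie M q X φ (r ⊗ₜ exteriorPower.ιMulti F q v) =
      ⁅X, φ (r ⊗ₜ exteriorPower.ιMulti F q v)⁆ - φ (δ X r ⊗ₜ exteriorPower.ιMulti F q v) -
        ∑ j, φ (r ⊗ₜ exteriorPower.ιMulti F q (Function.update v j ⁅X, v j⁆)) := by
  change cochainEquiv M q (altLie X ((cochainEquiv M q).symm φ)) _ = _
  rw [cochainEquiv_tmul, altLie_apply]
  simp only [cochainEquiv_symm_apply]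
  rw [cochain_tmul M q φ r, cochain_tmul M q φ (δ X r), ← lie_r_smul M X r, smul_sub,
    Finset.smul_sum, sub_sub_cancel]
  congr 1
  exact Finset.sum_congr rfl fun j _ => (cochain_tmul M q φ r _).symm

theorem cochainLie_lie (M : ULC δ) (q : ℕ) (X Y : L) : cochainLie M q ⁅X, Y⁆ =
    cochainLie M q X * cochainLie M q Y - cochainLie M q Y * cochainLie M q X := by
  refine LinearMap.ext fun φ => ?_
  simp [cochainLie, altLie_lie]

theorem cochainD_cochainD (M : ULC δ) (q : ℕ) (φ : Cochain M q) :
    cochainD M (q + 1) (cochainD M q φ) = 0 := by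
  simp [cochainD, altD_altD]

theorem cochainD_cochainLie (M : ULC δ) (q : ℕ) (X : L) (φ : Cochain M q) :
    cochainD M q (cochainLie M q X φ) = cochainLie M (q + 1) X (cochainD M q φ) := by
  simp [cochainD, cochainLie, altD_altLie]

/-- The map `C^q(M) → C^q(N)` given by composition with a morphism `M → N`. -/
def cochainMap {M N : ULC δ} (f : M ⟶ N) (q : ℕ) : Cochain M q →ₗ[F] Cochain N q where
  toFun φ := homR f ∘ₗ φ
  map_add' _ _ := LinearMap.comp_add _ _ _
  map_smul' c φ := LinearMap.ext fun z => hom_f_smul f c (φ z)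

theorem cochainMap_cochainEquiv {M N : ULC δ} (f : M ⟶ N) (q : ℕ) (φ : L [⋀^Fin q]→ₗ[F] M) :
    cochainMap f q (cochainEquiv M q φ) =
      cochainEquiv N q ((homF f).compAlternatingMap φ) := by
  apply (cochainEquiv N q).symm.injective
  ext v
  rw [cochainEquiv_symm_apply, LinearEquiv.symm_apply_apply]
  change f.hom (cochainEquiv M q φ _) = f.hom (φ v)
  rw [cochainEquiv_tmul, one_smul]

theorem altLie_homF {M N : ULC δ} (f : M ⟶ N) (q : ℕ) (X : L) (φ : L [⋀^Fin q]→ₗ[F] M) :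
    altLie X ((homF f).compAlternatingMap φ) = (homF f).compAlternatingMap (altLie X φ) := by
  ext v
  have h : ∀ m, homF f ⁅X, m⁆ = ⁅X, homF f m⁆ := hom_lie f X
  simp [altLie_apply, h]

theorem altD_homF {M N : ULC δ} (f : M ⟶ N) (q : ℕ) (φ : L [⋀^Fin q]→ₗ[F] M) :
    altD q ((homF f).compAlternatingMap φ) = (homF f).compAlternatingMap (altD q φ) := by
  induction q with
  | zero =>
    refine ext_curryLeft fun X => ?_
    rw [curryLeft_altD_zero, altLie_homF, AlternatingMap.curryLeft_compAlternatingMap,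
      curryLeft_altD_zero]
  | succ q ih =>
    refine ext_curryLeft fun X => ?_
    rw [curryLeft_altD, altLie_homF, AlternatingMap.curryLeft_compAlternatingMap,
      AlternatingMap.curryLeft_compAlternatingMap, ih, curryLeft_altD]
    ext v
    simp

theorem cochainMap_cochainLie {M N : ULC δ} (f : M ⟶ N) (q : ℕ) (X : L) (φ : Cochain M q) :
    cochainMap f q (cochainLie M q X φ) = cochainLie N q X (cochainMap f q φ) := by
  obtain ⟨ψ, rfl⟩ := (cochainEquiv M q).surjective φ
  simp [cochainLie, cochainMap_cochainEquiv, altLie_homF]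

theorem cochainMap_cochainD {M N : ULC δ} (f : M ⟶ N) (q : ℕ) (φ : Cochain M q) :
    cochainMap f (q + 1) (cochainD M q φ) = cochainD N q (cochainMap f q φ) := by
  obtain ⟨ψ, rfl⟩ := (cochainEquiv M q).surjective φ
  simp [cochainD, cochainMap_cochainEquiv, altD_homF]

variable (δ)

/-- The space `C^q(M)` as an `(L, R)`-module, with `R` acting through `ω`. -/
abbrev ceX (ω : R →ₐ[F] F) (M : ULC δ) (q : ℕ) : GRMod F L R :=
  GRMod.ofUnity ω (cochainLie M q) (cochainLie_lie M q)

/-- The differential as a morphism of `(L, R)`-modules. -/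
abbrev ceD (ω : R →ₐ[F] F) (M : ULC δ) (q : ℕ) : ceX δ ω M q ⟶ ceX δ ω M (q + 1) :=
  GRMod.homUnity (cochainD M q) (cochainD_cochainLie M q)

theorem ceD_comp_ceD (ω : R →ₐ[F] F) (M : ULC δ) (q : ℕ) :
    ceD δ ω M q ≫ ceD δ ω M (q + 1) = 0 :=
  GRMod.hom_ext' fun φ => cochainD_cochainD M q φ

/-- The morphism `C^q(M) → C^q(N)` induced by `M → N`. -/
abbrev ceMap (ω : R →ₐ[F] F) {M N : ULC δ} (f : M ⟶ N) (q : ℕ) : ceX δ ω M q ⟶ ceX δ ω N q :=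
  GRMod.homUnity (cochainMap f q) (cochainMap_cochainLie f q)

theorem ceMap_comp_ceD (ω : R →ₐ[F] F) {M N : ULC δ} (f : M ⟶ N) (q : ℕ) :
    ceMap δ ω f q ≫ ceD δ ω N q = ceD δ ω M q ≫ ceMap δ ω f (q + 1) :=
  GRMod.hom_ext' fun φ => (cochainMap_cochainD f q φ).symm

theorem ceMap_id (ω : R →ₐ[F] F) (M : ULC δ) (q : ℕ) : ceMap δ ω (𝟙 M) q = 𝟙 _ :=
  GRMod.hom_ext' fun _ => rfl

theorem ceMap_comp (ω : R →ₐ[F] F) {M N P : ULC δ} (f : M ⟶ N) (g : N ⟶ P) (q : ℕ) :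
    ceMap δ ω (f ≫ g) q = ceMap δ ω f q ≫ ceMap δ ω g q :=
  GRMod.hom_ext' fun _ => rfl

/-- The extended Chevalley-Eilenberg complex `C(M)`, as a functor from universal Lie-Cartan
modules to cochain complexes of `(L, R)`-modules (with `R` acting through `ω`). -/
def ceComplex (ω : R →ₐ[F] F) : ULC δ ⥤ CochainComplex (GRMod F L R) ℕ where
  obj M := CochainComplex.of (ceX δ ω M) (ceD δ ω M) (ceD_comp_ceD δ ω M)
  map f := CochainComplex.ofHom (ceMap δ ω f) (fun q => by
    simpa only [CochainComplex.of_d] using ceMap_comp_ceD δ ω f q)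
  map_id M := HomologicalComplex.hom_ext _ _ (ceMap_id δ ω M)
  map_comp f g := HomologicalComplex.hom_ext _ _ (ceMap_comp δ ω f g)

/-- The `q`-th cohomology `R^q Γ`, the `q`-th right derived functor of `Γ = Hom(R, -)`. -/
abbrev ulcCohomology (ω : R →ₐ[F] F) (q : ℕ) : ULC δ ⥤ GRMod F L R :=
  (homFromR δ ω).rightDerived q

/-- The `q`-th cohomology of the extended Chevalley-Eilenberg complex. -/
abbrev ceCohomology (ω : R →ₐ[F] F) (q : ℕ) : ULC δ ⥤ GRMod F L R :=
  ceComplex δ ω ⋙ HomologicalComplex.homologyFunctor (GRMod F L R) (ComplexShape.up ℕ) q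

end Category

section VectorFields

variable (F : Type u) [Field F]

/-- `W(n)`, the Lie algebra of all derivations of `F[x₁,…,x_n]`. -/
abbrev W (n : ℕ) : Type u := Derivation F (MvPolynomial (Fin n) F) (MvPolynomial (Fin n) F)

variable {F} in
theorem derivation_eq_sum {n : ℕ} (D : W F n) (f : MvPolynomial (Fin n) F) :
    D f = ∑ j, D (MvPolynomial.X j) * MvPolynomial.pderiv j f := by
  have hs : ∀ f, (∑ j, D (MvPolynomial.X j) • MvPolynomial.pderiv (R := F) j) f =
      ∑ j, D (MvPolynomial.X j) * MvPolynomial.pderiv j f := by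
    intro f
    have h := map_sum (Derivation.coeFnAddMonoidHom (R := F) (A := MvPolynomial (Fin n) F)
      (M := MvPolynomial (Fin n) F))
      (fun j => D (MvPolynomial.X j) • MvPolynomial.pderiv (R := F) j) Finset.univ
    have h2 := congrFun h f
    rw [Finset.sum_apply] at h2
    exact h2
  rw [← hs]
  refine congrArg (fun E : W F n => E f) (MvPolynomial.derivation_ext fun i => ?_)
  rw [hs]
  simp [MvPolynomial.pderiv_X, Pi.single_apply]

variable {F} in
theorem pderiv_derivation {n : ℕ} (D : W F n) (i : Fin n) (f : MvPolynomial (Fin n) F) :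
    MvPolynomial.pderiv i (D f) = D (MvPolynomial.pderiv i f) +
      ∑ j, MvPolynomial.pderiv i (D (MvPolynomial.X j)) * MvPolynomial.pderiv j f := by
  have h := derivation_eq_sum ⁅MvPolynomial.pderiv (R := F) i, D⁆ f
  simp only [Derivation.commutator_apply, MvPolynomial.pderiv_X, Pi.single_apply,
    apply_ite D, map_zero, Derivation.map_one_eq_zero, ite_self, sub_zero] at h
  rw [← h]
  abel

/-- `S(n)`, the vector fields `∑ f_i ∂_i` (so `f_i = D(x_i)`) with divergence `∑ ∂_i(f_i)` zero. -/
def S (n : ℕ) : LieSubalgebra F (W F n) where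
  carrier := {D | ∑ i, MvPolynomial.pderiv i (D (MvPolynomial.X i)) = 0}
  zero_mem' := by simp
  add_mem' {D E} hD hE := by
    change ∑ i, MvPolynomial.pderiv i (D (MvPolynomial.X i)) = 0 at hD
    change ∑ i, MvPolynomial.pderiv i (E (MvPolynomial.X i)) = 0 at hE
    change ∑ i, MvPolynomial.pderiv i ((D + E) (MvPolynomial.X i)) = 0
    simp [Finset.sum_add_distrib, hD, hE]
  smul_mem' c D hD := by
    change ∑ i, MvPolynomial.pderiv i (D (MvPolynomial.X i)) = 0 at hD
    change ∑ i, MvPolynomial.pderiv i ((c • D) (MvPolynomial.X i)) = 0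
    simp [← Finset.smul_sum, hD]
  lie_mem' {D E} hD hE := by
    change ∑ i, MvPolynomial.pderiv i (D (MvPolynomial.X i)) = 0 at hD
    change ∑ i, MvPolynomial.pderiv i (E (MvPolynomial.X i)) = 0 at hE
    change ∑ i, MvPolynomial.pderiv i (⁅D, E⁆ (MvPolynomial.X i)) = 0
    have h : ∀ i, MvPolynomial.pderiv i (⁅D, E⁆ (MvPolynomial.X i)) =
        D (MvPolynomial.pderiv i (E (MvPolynomial.X i))) +
          (∑ j, MvPolynomial.pderiv i (D (MvPolynomial.X j)) *
            MvPolynomial.pderiv j (E (MvPolynomial.X i))) -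
        (E (MvPolynomial.pderiv i (D (MvPolynomial.X i))) +
          ∑ j, MvPolynomial.pderiv i (E (MvPolynomial.X j)) *
            MvPolynomial.pderiv j (D (MvPolynomial.X i))) := by
      intro i
      rw [Derivation.commutator_apply, map_sub, pderiv_derivation D i (E _), pderiv_derivation E i (D _)]
    rw [Finset.sum_congr rfl fun i _ => h i]
    rw [Finset.sum_sub_distrib, Finset.sum_add_distrib, Finset.sum_add_distrib, ← map_sum,
      ← map_sum, hD, hE, map_zero, map_zero, zero_add, zero_add]
    rw [Finset.sum_comm, sub_eq_zero]
    exact Finset.sum_congr rfl fun i _ => Finset.sum_congr rfl fun j _ => mul_comm _ _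

/-- The value `∑_{i ≤ r} (D(x_i) E(x_{i+r}) - E(x_i) D(x_{i+r}))` of the 2-form
`∑_{i ≤ r} dx_i ∧ dx_{i+r}` on two vector fields. -/
def symp (r : ℕ) (D E : W F (r + r)) : MvPolynomial (Fin (r + r)) F :=
  ∑ i : Fin r, (D (MvPolynomial.X (Fin.castAdd r i)) * E (MvPolynomial.X (Fin.natAdd r i)) -
    E (MvPolynomial.X (Fin.castAdd r i)) * D (MvPolynomial.X (Fin.natAdd r i)))

theorem symp_add_left (r : ℕ) (D D' E : W F (r + r)) :
    symp F r (D + D') E = symp F r D E + symp F r D' E := by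
  simp only [symp, Derivation.add_apply, ← Finset.sum_add_distrib]
  exact Finset.sum_congr rfl fun i _ => by ring

theorem symp_swap (r : ℕ) (D E : W F (r + r)) : symp F r D E = - symp F r E D := by
  simp only [symp, ← Finset.sum_neg_distrib]
  exact Finset.sum_congr rfl fun i _ => by ring

theorem symp_add_right (r : ℕ) (D E E' : W F (r + r)) :
    symp F r D (E + E') = symp F r D E + symp F r D E' := by
  rw [symp_swap, symp_add_left, symp_swap F r E D, symp_swap F r E' D]
  ring

theorem symp_smul_left (r : ℕ) (c : F) (D E : W F (r + r)) :
    symp F r (c • D) E = c • symp F r D E := by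
  simp only [symp, Derivation.smul_apply, Finset.smul_sum, smul_sub, smul_mul_assoc,
    mul_smul_comm]

theorem symp_smul_right (r : ℕ) (c : F) (D E : W F (r + r)) :
    symp F r D (c • E) = c • symp F r D E := by
  rw [symp_swap, symp_smul_left, symp_swap F r E D, smul_neg, neg_neg]

theorem symp_sub_left (r : ℕ) (D D' E : W F (r + r)) :
    symp F r (D - D') E = symp F r D E - symp F r D' E := by
  have := symp_add_left F r (D - D') D' E
  rw [sub_add_cancel] at this
  rw [this, add_sub_cancel_right]

theorem symp_sub_right (r : ℕ) (D E E' : W F (r + r)) :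
    symp F r D (E - E') = symp F r D E - symp F r D E' := by
  have := symp_add_right F r D (E - E') E'
  rw [sub_add_cancel] at this
  rw [this, add_sub_cancel_right]

/-- `H(2r)`, the vector fields `D` which annihilate the 2-form `σ = ∑_{i ≤ r} dx_i ∧ dx_{i+r}`: the
Lie derivative `(E, E') ↦ D(σ(E, E')) - σ([D, E], E') - σ(E, [D, E'])` vanishes. -/
def H (r : ℕ) : LieSubalgebra F (W F (r + r)) where
  carrier := {D | ∀ E E' : W F (r + r),
    D (symp F r E E') - symp F r ⁅D, E⁆ E' - symp F r E ⁅D, E'⁆ = 0}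
  zero_mem' := by
    intro E E'
    have h : ∀ E : W F (r + r), ⁅(0 : W F (r + r)), E⁆ = (0 : F) • E := fun E =>
      (zero_lie E).trans (zero_smul F E).symm
    rw [h, h, symp_smul_left, symp_smul_right]
    simp
  add_mem' {D D'} hD hD' := by
    intro E E'
    have h := hD E E'
    have h' := hD' E E'
    have hb : ∀ E : W F (r + r), ⁅D + D', E⁆ = ⁅D, E⁆ + ⁅D', E⁆ := fun E => add_lie D D' E
    rw [hb, hb, symp_add_left, symp_add_right, Derivation.add_apply]
    linear_combination h + h'
  smul_mem' c D hD := by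
    intro E E'
    have hb : ∀ E : W F (r + r), ⁅c • D, E⁆ = c • ⁅D, E⁆ := fun E => smul_lie c D E
    rw [hb, hb, symp_smul_left, symp_smul_right, Derivation.smul_apply, ← smul_sub,
      ← smul_sub, hD E E', smul_zero]
  lie_mem' {D D'} hD hD' := by
    have h : ∀ E E', D (symp F r E E') = symp F r ⁅D, E⁆ E' + symp F r E ⁅D, E'⁆ := by
      intro E E'
      linear_combination hD E E'
    have h' : ∀ E E', D' (symp F r E E') = symp F r ⁅D', E⁆ E' + symp F r E ⁅D', E'⁆ := by
      intro E E'
      linear_combination hD' E E'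
    intro E E'
    have hb : ∀ E : W F (r + r), ⁅⁅D, D'⁆, E⁆ = ⁅D, ⁅D', E⁆⁆ - ⁅D', ⁅D, E⁆⁆ := fun E =>
      lie_lie D D' E
    rw [Derivation.commutator_apply, hb, hb, symp_sub_left, symp_sub_right, h', h,
      map_add, map_add, h, h, h', h']
    ring

/-- The Lie algebras of vector fields `X(n)`, `X ∈ {W, S, H}` (with `n = 2r` even for `H`). -/
inductive IsVectorFieldAlgebra : (n : ℕ) → LieSubalgebra F (W F n) → Prop
  | typeW (n : ℕ) : IsVectorFieldAlgebra n ⊤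
  | typeS (n : ℕ) : IsVectorFieldAlgebra n (S F n)
  | typeH (r : ℕ) : IsVectorFieldAlgebra (r + r) (H F r)

/-- The unity map `ω : F[x₁,…,x_n] → F`, the algebra homomorphism with kernel `(x₁,…,x_n)`. -/
def unity (n : ℕ) : MvPolynomial (Fin n) F →ₐ[F] F := MvPolynomial.aeval 0

end VectorFields

end UniversalLieCartan

end

/-! Universal Lie-Cartan modules are the modules over the ring A = `NatAlg δ`, and both cohomologies
compute Ext^q_A(R, M). Since Γ is Hom_A(R, -), applying it to an injective resolution of M computes
Ext. On the other side, C(M) is Hom_A(P, M) for the Koszul complex P_q = A ⊗ ⋀^q L, a resolution of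
R by free A-modules: an A-linear map out of P_q is the same as an alternating q-form, and
precomposition with the Koszul differential is the Chevalley-Eilenberg differential
(`koszulComplex_d_formHom`). The two descriptions are compatible with scalars from F and with
morphisms in M. As f ∈ R acts on both sides by the scalar ω(f), the resulting bijection is R-linear
and natural.

The substance is the exactness of the augmented Koszul complex (`koszul_exact_succ`,
`koszul_exact_zero`). The model is the classical Koszul complex Sym ⊗ ⋀, contracted by the de Rham
differential: there the anticommutator of the two differentials is multiplication by the total
degree, which is invertible in characteristic 0 away from degree zero.

To imitate the de Rham differential on A without a Poincaré-Birkhoff-Witt basis, the coaction A → A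
⊗ U(L) is composed with a linear map p : U(L) → L such that p(1) = 0 and p(X) = X. Such a p exists
because L acts faithfully on R (`exists_retraction`). Modulo lower order the composite `linPart` is
r X₁⋯X_m ↦ ∑ r X₁⋯X̂ᵢ⋯X_m ⊗ Xᵢ, and wedging its second factor into ⋀ gives the homotopy `koszulH`.
By `koszul_homotopy_mem` the anticommutator of `koszulD` and `koszulH` on order m and exterior
degree q + 1 is multiplication by m + q + 1, up to lower order, so induction on the order shows that
cycles bound. In exterior degree 0 the factor m vanishes only in order 0, where exactly R remains.

The argument applies to every Lie algebra acting faithfully by derivations; a subalgebra of W(n)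
does so through its inclusion. -/

noncomputable section

namespace UniversalLieCartan

open scoped TensorProduct

/-! ### Subspaces of a tensor product induced by subspaces of the left factor -/

section TensorFiltration

variable {F : Type u} [Field F] {A V V' : Type u} [AddCommGroup A] [Module F A]
  [AddCommGroup V] [Module F V] [AddCommGroup V'] [Module F V']

/-- The image of `G ⊗ V` in `A ⊗ V`, for a subspace `G` of `A`. -/
def tensorSub (V : Type u) [AddCommGroup V] [Module F V] (G : Submodule F A) :
    Submodule F (A ⊗[F] V) :=
  Submodule.map₂ (TensorProduct.mk F A V) G ⊤

theorem tmul_mem_tensorSub {G : Submodule F A} {a : A} (ha : a ∈ G) (v : V) :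
    a ⊗ₜ[F] v ∈ tensorSub V G :=
  Submodule.apply_mem_map₂ _ ha trivial

theorem tensorSub_le {G : Submodule F A} {T : Submodule F (A ⊗[F] V)}
    (h : ∀ a ∈ G, ∀ v : V, a ⊗ₜ[F] v ∈ T) : tensorSub V G ≤ T :=
  Submodule.map₂_le.2 fun a ha v _ => h a ha v

/-- All later estimates "modulo lower order" are membership statements of this shape, for f a
difference of two linear maps; linearity reduces them to pure tensors. -/
theorem map_tensorSub {B : Type u} [AddCommGroup B] [Module F B] {G : Submodule F A}
    {T : Submodule F B} (f : A ⊗[F] V →ₗ[F] B)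
    (h : ∀ a ∈ G, ∀ v : V, f (a ⊗ₜ[F] v) ∈ T) {z : A ⊗[F] V} (hz : z ∈ tensorSub V G) :
    f z ∈ T :=
  tensorSub_le (T := T.comap f) h hz

theorem tensorSub_mono {G G' : Submodule F A} (h : G ≤ G') : tensorSub V G ≤ tensorSub V G' :=
  Submodule.map₂_le_map₂_left h

theorem tensorSub_bot : tensorSub V (⊥ : Submodule F A) = ⊥ := Submodule.map₂_bot_left _ _

theorem lTensor_mem_tensorSub (f : V →ₗ[F] V') {G : Submodule F A} {z : A ⊗[F] V}
    (hz : z ∈ tensorSub V G) : LinearMap.lTensor A f z ∈ tensorSub V' G :=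
  map_tensorSub _ (fun _ ha v => tmul_mem_tensorSub ha (f v)) hz

end TensorFiltration

/-! ### The order filtration, the coaction and Euler's formula -/

section OrderFiltration

attribute [local instance 100] LieRing.ofAssociativeRing

variable {F : Type u} [Field F] {L : Type u} [LieRing L] [LieAlgebra F L]
  {R : Type u} [CommRing R] [Algebra F R] (δ : L →ₗ⁅F⁆ Derivation F R R)

/-- If `L` acts faithfully on `R`, then `L → U(L)` has a linear retraction killing the scalars. -/
theorem exists_retraction (hδ : Function.Injective δ) :
    ∃ p : UniversalEnvelopingAlgebra F L →ₗ[F] L,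
      p 1 = 0 ∧ ∀ X, p (UniversalEnvelopingAlgebra.ι F X) = X := by
  let ρ : L →ₗ⁅F⁆ Module.End F R :=
    { toFun := fun X => (δ X : R →ₗ[F] R)
      map_add' := fun X Y => by simp
      map_smul' := fun c X => by simp
      map_lie' := fun {X Y} => by ext; simp [LieRing.of_associative_ring_bracket] }
  let E := F ∙ (1 : UniversalEnvelopingAlgebra F L)
  let j : L →ₗ[F] UniversalEnvelopingAlgebra F L ⧸ E :=
    E.mkQ ∘ₗ (UniversalEnvelopingAlgebra.ι F : L →ₗ⁅F⁆ _).toLinearMap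
  -- If the image of X in U(L) is a scalar c, then X acts on R as multiplication by c. A derivation
  -- kills 1, so c vanishes in R, hence X acts by zero and faithfulness gives X = 0.
  have hj : LinearMap.ker j = ⊥ := by
    refine (LinearMap.ker_eq_bot' ).2 fun X hX => hδ ?_
    have hX' : UniversalEnvelopingAlgebra.ι F X ∈ E := (Submodule.Quotient.mk_eq_zero E).1 hX
    obtain ⟨c, hc⟩ := Submodule.mem_span_singleton.1 hX'
    have h1 : c • (1 : Module.End F R) = ρ X := by
      rw [← UniversalEnvelopingAlgebra.lift_ι_apply F ρ X, ← hc, map_smul, map_one]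
    have h2 : ∀ r : R, c • r = δ X r := fun r => LinearMap.congr_fun h1 r
    have h3 : algebraMap F R c = 0 := by
      rw [Algebra.algebraMap_eq_smul_one, h2, Derivation.map_one_eq_zero]
    rw [map_zero]
    ext r
    rw [← h2, Algebra.smul_def, h3, zero_mul]
    rfl
  obtain ⟨p, hp⟩ := j.exists_leftInverse_of_injective hj
  refine ⟨p ∘ₗ E.mkQ, ?_, fun X => LinearMap.congr_fun hp X⟩
  have : E.mkQ 1 = 0 := (Submodule.Quotient.mk_eq_zero E).2 (Submodule.mem_span_singleton_self _)
  rw [LinearMap.comp_apply, this, map_zero]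

/-- The coaction `R ♮ U(L) → (R ♮ U(L)) ⊗ U(L)` with `r ↦ r ⊗ 1` and `X ↦ X ⊗ 1 + 1 ⊗ X`. -/
def coaction : NatAlg δ →ₐ[F] NatAlg δ ⊗[F] UniversalEnvelopingAlgebra F L :=
  NatAlg.lift δ (Algebra.TensorProduct.includeLeft.comp (NatAlg.ofR δ))
    ((TensorProduct.mk F (NatAlg δ) (UniversalEnvelopingAlgebra F L)).flip 1 ∘ₗ NatAlg.ofL δ +
      TensorProduct.mk F (NatAlg δ) (UniversalEnvelopingAlgebra F L) 1 ∘ₗ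
        (UniversalEnvelopingAlgebra.ι F : L →ₗ⁅F⁆ _).toLinearMap)
    -- The elements X ⊗ 1 and 1 ⊗ Y commute, so the cross terms of the commutator cancel and the
    -- bracket is computed in each factor separately.
    (by
      intro X Y
      simp [NatAlg.ofL_lie, LieRing.of_associative_ring_bracket, TensorProduct.tmul_sub,
        mul_add, add_mul]
      abel)
    (by
      intro X a
      simp [← NatAlg.ofL_mul_ofR, TensorProduct.sub_tmul, mul_add, add_mul])

theorem coaction_ofR (r : R) : coaction δ (NatAlg.ofR δ r) = NatAlg.ofR δ r ⊗ₜ 1 :=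
  NatAlg.lift_ofR δ _ _ _ _ r

theorem coaction_ofL (X : L) : coaction δ (NatAlg.ofL δ X) =
    NatAlg.ofL δ X ⊗ₜ 1 + 1 ⊗ₜ UniversalEnvelopingAlgebra.ι F X :=
  NatAlg.lift_ofL δ _ _ _ _ X

/-- The filtration of `R ♮ U(L)` by order, shifted by one: `ordFil δ (n + 1)` is spanned by the
products `r X₁ ⋯ X_m` with `m ≤ n`. -/
def ordFil : ℕ → Submodule F (NatAlg δ)
  | 0 => ⊥
  | n + 1 => LinearMap.range (NatAlg.ofR δ).toLinearMap ⊔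
      Submodule.map₂ (LinearMap.mul F (NatAlg δ)) (ordFil n) (LinearMap.range (NatAlg.ofL δ))

variable {δ}

theorem ofR_mem_ordFil (n : ℕ) (r : R) : NatAlg.ofR δ r ∈ ordFil δ (n + 1) :=
  Submodule.mem_sup_left ⟨r, rfl⟩

theorem mul_ofL_mem_ordFil {n : ℕ} {a : NatAlg δ} (ha : a ∈ ordFil δ n) (X : L) :
    a * NatAlg.ofL δ X ∈ ordFil δ (n + 1) :=
  Submodule.mem_sup_right (Submodule.apply_mem_map₂ (LinearMap.mul F (NatAlg δ)) ha ⟨X, rfl⟩)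

theorem ordFil_succ_le {n : ℕ} {T : Submodule F (NatAlg δ)} (hR : ∀ r, NatAlg.ofR δ r ∈ T)
    (hL : ∀ a ∈ ordFil δ n, ∀ X, a * NatAlg.ofL δ X ∈ T) : ordFil δ (n + 1) ≤ T := by
  refine sup_le ?_ (Submodule.map₂_le.2 ?_)
  · rintro _ ⟨r, rfl⟩
    exact hR r
  · rintro a ha _ ⟨X, rfl⟩
    exact hL a ha X

theorem ordFil_mono : Monotone (ordFil δ) := by
  refine monotone_nat_of_le_succ fun n => ?_
  induction n with
  | zero => exact bot_le
  | succ n ih =>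
    exact ordFil_succ_le (ofR_mem_ordFil _) fun a ha X => mul_ofL_mem_ordFil (ih ha) X

/-- The algebra is spanned by products of an element of R with an element of U(L) on its right, so
it suffices that right multiplication by U(L) preserves finite order. This exhaustion is what allows
exactness to be proved by induction on the order. -/
theorem exists_mem_ordFil (a : NatAlg δ) : ∃ n, a ∈ ordFil δ n := by
  have hadd : ∀ a b : NatAlg δ, (∃ n, a ∈ ordFil δ n) → (∃ n, b ∈ ordFil δ n) →
      ∃ n, a + b ∈ ordFil δ n := by
    rintro a b ⟨n, hn⟩ ⟨m, hm⟩
    exact ⟨max n m, add_mem (ordFil_mono (le_max_left _ _) hn) (ordFil_mono (le_max_right _ _) hm)⟩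
  have hU : ∀ (u : UniversalEnvelopingAlgebra F L) (a : NatAlg δ), (∃ n, a ∈ ordFil δ n) →
      ∃ n, a * NatAlg.ofU δ u ∈ ordFil δ n := by
    intro u
    induction u using envelopingAlgebra_induction with
    | halg c =>
      rintro a ⟨n, hn⟩
      refine ⟨n, ?_⟩
      rw [AlgHom.commutes, ← Algebra.commutes, ← Algebra.smul_def]
      exact Submodule.smul_mem _ c hn
    | hι X =>
      rintro a ⟨n, hn⟩
      exact ⟨n + 1, mul_ofL_mem_ordFil hn X⟩
    | hadd u v hu hv =>
      intro a ha
      rw [map_add, mul_add]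
      exact hadd _ _ (hu a ha) (hv a ha)
    | hmul u v hu hv =>
      intro a ha
      rw [map_mul, ← mul_assoc]
      exact hv _ (hu a ha)
  refine TensorProduct.induction_on (motive := fun a : R ⊗[F] UniversalEnvelopingAlgebra F L =>
    ∃ n, (show NatAlg δ from a) ∈ ordFil δ n) a ⟨0, zero_mem _⟩ (fun r u => ?_) fun x y => hadd x y
  rw [← NatAlg.ofR_mul_ofU]
  exact hU u _ ⟨1, ofR_mem_ordFil 0 r⟩

theorem mul_tmul_one_mem {n : ℕ} {z : NatAlg δ ⊗[F] UniversalEnvelopingAlgebra F L}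
    (hz : z ∈ tensorSub _ (ordFil δ n)) (X : L) :
    z * (NatAlg.ofL δ X ⊗ₜ 1) ∈ tensorSub _ (ordFil δ (n + 1)) :=
  map_tensorSub (LinearMap.mulRight F (NatAlg.ofL δ X ⊗ₜ 1)) (fun a ha u => by
    rw [LinearMap.mulRight_apply, Algebra.TensorProduct.tmul_mul_tmul]
    exact tmul_mem_tensorSub (mul_ofL_mem_ordFil ha X) _) hz

theorem mul_one_tmul_mem {n : ℕ} {z : NatAlg δ ⊗[F] UniversalEnvelopingAlgebra F L}
    (hz : z ∈ tensorSub _ (ordFil δ n)) (u : UniversalEnvelopingAlgebra F L) :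
    z * (1 ⊗ₜ u) ∈ tensorSub _ (ordFil δ n) :=
  map_tensorSub (LinearMap.mulRight F (1 ⊗ₜ u)) (fun a ha v => by
    rw [LinearMap.mulRight_apply, Algebra.TensorProduct.tmul_mul_tmul, mul_one]
    exact tmul_mem_tensorSub ha _) hz

/-- Modulo lower order, `coaction δ a` is `a ⊗ 1`. -/
theorem coaction_sub_mem (n : ℕ) {a : NatAlg δ} (ha : a ∈ ordFil δ (n + 1)) :
    coaction δ a - a ⊗ₜ 1 ∈ tensorSub _ (ordFil δ n) := by
  induction n generalizing a with
  | zero =>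
    refine ordFil_succ_le (T := (tensorSub _ (ordFil δ 0)).comap ((coaction δ).toLinearMap -
      (TensorProduct.mk F (NatAlg δ) (UniversalEnvelopingAlgebra F L)).flip 1))
      (fun r => ?_) (fun a ha X => ?_) ha
    · simp [coaction_ofR]
    · obtain rfl : a = 0 := ha
      rw [zero_mul]
      exact zero_mem _
  | succ n ih =>
    refine ordFil_succ_le (T := (tensorSub _ (ordFil δ (n + 1))).comap ((coaction δ).toLinearMap -
      (TensorProduct.mk F (NatAlg δ) (UniversalEnvelopingAlgebra F L)).flip 1))
      (fun r => ?_) (fun a ha X => ?_) ha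
    · simp [coaction_ofR]
    · have h : (coaction δ).toLinearMap (a * NatAlg.ofL δ X) - (a * NatAlg.ofL δ X) ⊗ₜ 1 =
          (coaction δ a - a ⊗ₜ 1) * (NatAlg.ofL δ X ⊗ₜ 1) +
          ((coaction δ a - a ⊗ₜ 1) * (1 ⊗ₜ UniversalEnvelopingAlgebra.ι F X) +
            a ⊗ₜ UniversalEnvelopingAlgebra.ι F X) := by
        rw [AlgHom.toLinearMap_apply, map_mul, coaction_ofL, sub_mul, sub_mul, mul_add,
          Algebra.TensorProduct.tmul_mul_tmul, Algebra.TensorProduct.tmul_mul_tmul, mul_one,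
          mul_one, one_mul]
        abel
      change (coaction δ).toLinearMap (a * NatAlg.ofL δ X) - (a * NatAlg.ofL δ X) ⊗ₜ 1 ∈
        tensorSub _ (ordFil δ (n + 1))
      rw [h]
      exact add_mem (mul_tmul_one_mem (ih ha) X) (add_mem
        (mul_one_tmul_mem (tensorSub_mono (ordFil_mono n.le_succ) (ih ha)) _)
        (tmul_mem_tensorSub ha _))

variable (p : UniversalEnvelopingAlgebra F L →ₗ[F] L)

variable (δ) in
/-- The linear part of the coaction with respect to a retraction `p : U(L) → L`; modulo lower
order it is `r X₁ ⋯ X_m ↦ ∑ᵢ r X₁ ⋯ X̂ᵢ ⋯ X_m ⊗ Xᵢ`. -/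
def linPart : NatAlg δ →ₗ[F] NatAlg δ ⊗[F] L :=
  LinearMap.lTensor _ p ∘ₗ (coaction δ).toLinearMap

variable {p} (hp1 : p 1 = 0) (hpι : ∀ X, p (UniversalEnvelopingAlgebra.ι F X) = X)
include hp1

theorem linPart_ofR (r : R) : linPart δ p (NatAlg.ofR δ r) = 0 := by
  rw [linPart, LinearMap.comp_apply, AlgHom.toLinearMap_apply, coaction_ofR, LinearMap.lTensor_tmul,
    hp1, TensorProduct.tmul_zero]

/-- The leading term a ⊗ 1 of the coaction is killed by p, so only the terms of lower order survive.
-/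
theorem linPart_mem {n : ℕ} {a : NatAlg δ} (ha : a ∈ ordFil δ (n + 1)) :
    linPart δ p a ∈ tensorSub L (ordFil δ n) := by
  have h := lTensor_mem_tensorSub p (coaction_sub_mem n ha)
  rwa [map_sub, LinearMap.lTensor_tmul, hp1, TensorProduct.tmul_zero, sub_zero] at h

include hpι

/-- Modulo lower order, `linPart` is a derivation with respect to right multiplication. -/
theorem linPart_mul_ofL {n : ℕ} {a : NatAlg δ} (ha : a ∈ ordFil δ (n + 1)) (X : L) :
    linPart δ p (a * NatAlg.ofL δ X) -
      (LinearMap.rTensor L (LinearMap.mulRight F (NatAlg.ofL δ X)) (linPart δ p a) + a ⊗ₜ X) ∈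
        tensorSub L (ordFil δ n) := by
  have h1 : ∀ z : NatAlg δ ⊗[F] UniversalEnvelopingAlgebra F L,
      LinearMap.lTensor _ p (z * (NatAlg.ofL δ X ⊗ₜ 1)) =
        LinearMap.rTensor L (LinearMap.mulRight F (NatAlg.ofL δ X)) (LinearMap.lTensor _ p z) := by
    intro z
    induction z with
    | zero => simp
    | add x y hx hy => rw [add_mul, map_add, hx, hy, map_add, map_add]
    | tmul b u => simp
  -- Expanding coaction(a) (X ⊗ 1 + 1 ⊗ X), the first summand gives the product rule term. In the
  -- second, replacing coaction(a) by a ⊗ 1 produces a ⊗ p(X) = a ⊗ X, and the error keeps its low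
  -- order since 1 ⊗ X multiplies only the right factor.
  have h2 := lTensor_mem_tensorSub p
    (mul_one_tmul_mem (coaction_sub_mem n ha) (UniversalEnvelopingAlgebra.ι F X))
  rw [sub_mul, map_sub, Algebra.TensorProduct.tmul_mul_tmul, mul_one, one_mul,
    LinearMap.lTensor_tmul, hpι] at h2
  convert h2 using 1
  rw [linPart, LinearMap.comp_apply, LinearMap.comp_apply, AlgHom.toLinearMap_apply,
    AlgHom.toLinearMap_apply, map_mul, coaction_ofL, mul_add, map_add, h1]
  abel

variable (δ) in
omit hp1 hpι in
/-- The multiplication `(R ♮ U(L)) ⊗ L → R ♮ U(L)`. -/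
def mulL : NatAlg δ ⊗[F] L →ₗ[F] NatAlg δ :=
  TensorProduct.lift ((LinearMap.mul F (NatAlg δ)).compl₂ (NatAlg.ofL δ))

omit hp1 hpι in
theorem mulL_tmul (a : NatAlg δ) (X : L) : mulL δ (a ⊗ₜ X) = a * NatAlg.ofL δ X := rfl

omit hp1 hpι in
-- Interchanging the last two factors costs a [X, Y], which adds one order instead of two.
theorem mulL_rTensor_sub_mem {n : ℕ} {z : NatAlg δ ⊗[F] L} (hz : z ∈ tensorSub L (ordFil δ n))
    (X : L) : mulL δ (LinearMap.rTensor L (LinearMap.mulRight F (NatAlg.ofL δ X)) z) -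
      mulL δ z * NatAlg.ofL δ X ∈ ordFil δ (n + 1) :=
  map_tensorSub (mulL δ ∘ₗ LinearMap.rTensor L (LinearMap.mulRight F (NatAlg.ofL δ X)) -
    LinearMap.mulRight F (NatAlg.ofL δ X) ∘ₗ mulL δ) (fun a ha Y => by
      have h : a * NatAlg.ofL δ X * NatAlg.ofL δ Y - a * NatAlg.ofL δ Y * NatAlg.ofL δ X =
          a * NatAlg.ofL δ ⁅X, Y⁆ := by
        rw [NatAlg.ofL_lie, mul_sub, mul_assoc, mul_assoc]
      change a * NatAlg.ofL δ X * NatAlg.ofL δ Y - a * NatAlg.ofL δ Y * NatAlg.ofL δ X ∈ _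
      rw [h]
      exact mul_ofL_mem_ordFil ha _) hz

/-- Euler's formula: modulo lower order, multiplying out `linPart a` gives `n a` for `a` of
order `n`. -/
theorem mulL_linPart_sub_mem (n : ℕ) {a : NatAlg δ} (ha : a ∈ ordFil δ (n + 1)) :
    mulL δ (linPart δ p a) - (n : F) • a ∈ ordFil δ n := by
  induction n generalizing a with
  | zero =>
    refine ordFil_succ_le (T := (ordFil δ 0).comap (mulL δ ∘ₗ linPart δ p -
      ((0 : ℕ) : F) • LinearMap.id)) (fun r => ?_) (fun a ha X => ?_) ha
    · simp [linPart_ofR hp1]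
    · obtain rfl : a = 0 := ha
      rw [zero_mul]
      exact zero_mem _
  | succ n ih =>
    refine ordFil_succ_le (T := (ordFil δ (n + 1)).comap (mulL δ ∘ₗ linPart δ p -
      ((n + 1 : ℕ) : F) • LinearMap.id)) (fun r => ?_) (fun a ha X => ?_) ha
    · simpa [linPart_ofR hp1] using Submodule.smul_mem _ _ (ofR_mem_ordFil n r)
    · have h1 : mulL δ (linPart δ p (a * NatAlg.ofL δ X) -
          (LinearMap.rTensor L (LinearMap.mulRight F (NatAlg.ofL δ X)) (linPart δ p a) +
            a ⊗ₜ X)) ∈ ordFil δ (n + 1) :=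
        map_tensorSub (mulL δ) (fun b hb Y => mul_ofL_mem_ordFil hb Y) (linPart_mul_ofL hp1 hpι ha X)
      have h2 := mulL_rTensor_sub_mem (linPart_mem hp1 ha) X
      have h3 := mul_ofL_mem_ordFil (ih ha) X
      change mulL δ (linPart δ p (a * NatAlg.ofL δ X)) -
        ((n + 1 : ℕ) : F) • (a * NatAlg.ofL δ X) ∈ ordFil δ (n + 1)
      convert add_mem (add_mem h1 h2) h3 using 1
      rw [map_sub, map_add, mulL_tmul, Nat.cast_succ, add_smul, one_smul, sub_mul, smul_mul_assoc]
      abel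

end OrderFiltration

/-! ### The Koszul complex and its contracting homotopy up to lower order -/

section KoszulComplex

variable {F : Type u} [Field F] {L : Type u} [LieRing L] [LieAlgebra F L]
  {R : Type u} [CommRing R] [Algebra F R] (δ : L →ₗ⁅F⁆ Derivation F R R)

/-- The left exterior multiplication `X, w ↦ X ∧ w`. -/
def wedge (F : Type u) [Field F] (L : Type u) [LieRing L] [LieAlgebra F L] (q : ℕ) :
    L →ₗ[F] ⋀[F]^q L →ₗ[F] ⋀[F]^(q + 1) L :=
  exteriorPower.alternatingMapLinearEquiv.toLinearMap ∘ₗ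
    (exteriorPower.ιMulti F (q + 1)).curryLeft

theorem wedge_ιMulti (q : ℕ) (X : L) (v : Fin q → L) :
    wedge F L q X (exteriorPower.ιMulti F q v) =
      exteriorPower.ιMulti F (q + 1) (Fin.cons X v : Fin (q + 1) → L) :=
  exteriorPower.alternatingMapLinearEquiv_apply_ιMulti _ v

/-- The terms `(R ♮ U(L)) ⊗ ⋀^q L` of the Koszul resolution of `R`. -/
abbrev Koszul (q : ℕ) : Type u := NatAlg δ ⊗[F] ⋀[F]^q L

instance (q : ℕ) : LieRingModule L (Koszul δ q) where
  bracket X m := NatAlg.ofL δ X • m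
  add_lie X Y m := by
    rw [map_add, add_smul]
  lie_add X m m' := smul_add (NatAlg.ofL δ X) m m'
  leibniz_lie X Y m := by
    change NatAlg.ofL δ X • NatAlg.ofL δ Y • m =
      NatAlg.ofL δ ⁅X, Y⁆ • m + NatAlg.ofL δ Y • NatAlg.ofL δ X • m
    rw [NatAlg.ofL_lie, sub_smul, mul_smul, mul_smul, sub_add_cancel]

theorem koszul_lie_def (q : ℕ) (X : L) (m : Koszul δ q) : ⁅X, m⁆ = NatAlg.ofL δ X • m := rfl

instance (q : ℕ) : LieModule F L (Koszul δ q) where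
  smul_lie c X m := by rw [koszul_lie_def, koszul_lie_def, map_smul, smul_assoc]
  lie_smul c X m := by rw [koszul_lie_def, koszul_lie_def, smul_comm]

variable {N N' : Type u} [AddCommGroup N] [Module F N] [Module (NatAlg δ) N]
  [IsScalarTower F (NatAlg δ) N] [AddCommGroup N'] [Module F N'] [Module (NatAlg δ) N']
  [IsScalarTower F (NatAlg δ) N']

variable {δ} in
/-- The `R ♮ U(L)`-linear map `(R ♮ U(L)) ⊗ ⋀^q L → N` attached to an alternating form. -/
def koszulLift {q : ℕ} (φ : L [⋀^Fin q]→ₗ[F] N) : Koszul δ q →ₗ[NatAlg δ] N :=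
  TensorProduct.AlgebraTensorModule.lift
    (LinearMap.toSpanSingleton (NatAlg δ) _ (exteriorPower.alternatingMapLinearEquiv φ))

variable {δ} in
theorem koszulLift_tmul {q : ℕ} (φ : L [⋀^Fin q]→ₗ[F] N) (a : NatAlg δ) (v : Fin q → L) :
    koszulLift φ (a ⊗ₜ exteriorPower.ιMulti F q v) = a • φ v := by
  change a • exteriorPower.alternatingMapLinearEquiv φ (exteriorPower.ιMulti F q v) = _
  rw [exteriorPower.alternatingMapLinearEquiv_apply_ιMulti]

/-- The universal alternating form `v ↦ 1 ⊗ v₁ ∧ … ∧ v_q`. -/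
def koszulForm (q : ℕ) : L [⋀^Fin q]→ₗ[F] Koszul δ q :=
  (TensorProduct.mk F (NatAlg δ) (⋀[F]^q L) 1).compAlternatingMap (exteriorPower.ιMulti F q)

theorem koszulForm_apply (q : ℕ) (v : Fin q → L) :
    koszulForm δ q v = 1 ⊗ₜ exteriorPower.ιMulti F q v := rfl

variable {δ} in
theorem koszul_ext {q : ℕ} {f g : Koszul δ q →ₗ[NatAlg δ] N}
    (h : ∀ v, f (koszulForm δ q v) = g (koszulForm δ q v)) : f = g := by
  refine TensorProduct.AlgebraTensorModule.ext fun a w => ?_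
  have h2 : (f.restrictScalars F).comp (TensorProduct.mk F (NatAlg δ) (⋀[F]^q L) 1) =
      (g.restrictScalars F).comp (TensorProduct.mk F (NatAlg δ) (⋀[F]^q L) 1) := by
    refine exteriorPower.linearMap_ext ?_
    ext v
    exact h v
  have h3 : a ⊗ₜ[F] w = a • ((1 : NatAlg δ) ⊗ₜ[F] w) := by
    rw [TensorProduct.smul_tmul', smul_eq_mul, mul_one]
  rw [h3, map_smul, map_smul]
  exact congrArg (a • ·) (LinearMap.congr_fun h2 w)

variable {δ} in
theorem koszulLift_koszulForm {q : ℕ} (φ : L [⋀^Fin q]→ₗ[F] N) (v : Fin q → L) :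
    koszulLift φ (koszulForm δ q v) = φ v := by
  rw [koszulForm_apply, koszulLift_tmul, one_smul]

variable {δ} in
theorem comp_koszulLift {q : ℕ} (g : N →ₗ[NatAlg δ] N') (φ : L [⋀^Fin q]→ₗ[F] N) :
    g ∘ₗ koszulLift φ = koszulLift ((g.restrictScalars F).compAlternatingMap φ) :=
  koszul_ext fun v => by
    rw [LinearMap.comp_apply, koszulLift_koszulForm, koszulLift_koszulForm]
    rfl

theorem altLie_compAlternatingMap {N N' : Type u} [AddCommGroup N] [Module F N]
    [LieRingModule L N] [LieModule F L N] [AddCommGroup N'] [Module F N'] [LieRingModule L N']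
    [LieModule F L N'] (f : N →ₗ[F] N') (hf : ∀ (X : L) m, f ⁅X, m⁆ = ⁅X, f m⁆) {q : ℕ} (X : L)
    (φ : L [⋀^Fin q]→ₗ[F] N) :
    altLie X (f.compAlternatingMap φ) = f.compAlternatingMap (altLie X φ) := by
  ext v
  simp [altLie_apply, hf]

/-- By Cartan's formula the differential is determined recursively by Lie derivatives and
contractions, both of which commute with a map of L-modules. Applied to the universal form, this
transfers identities of the Chevalley-Eilenberg differential to the Koszul differential. -/
theorem altD_compAlternatingMap {N N' : Type u} [AddCommGroup N] [Module F N]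
    [LieRingModule L N] [LieModule F L N] [AddCommGroup N'] [Module F N'] [LieRingModule L N']
    [LieModule F L N'] (f : N →ₗ[F] N') (hf : ∀ (X : L) m, f ⁅X, m⁆ = ⁅X, f m⁆) (q : ℕ)
    (φ : L [⋀^Fin q]→ₗ[F] N) :
    altD q (f.compAlternatingMap φ) = f.compAlternatingMap (altD q φ) := by
  induction q with
  | zero =>
    refine ext_curryLeft fun X => ?_
    rw [curryLeft_altD_zero, altLie_compAlternatingMap f hf,
      AlternatingMap.curryLeft_compAlternatingMap, curryLeft_altD_zero]
  | succ q ih =>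
    refine ext_curryLeft fun X => ?_
    rw [curryLeft_altD, altLie_compAlternatingMap f hf,
      AlternatingMap.curryLeft_compAlternatingMap, AlternatingMap.curryLeft_compAlternatingMap, ih,
      curryLeft_altD]
    ext v
    simp

/-- The differential of the Koszul resolution. -/
def koszulD (q : ℕ) : Koszul δ (q + 1) →ₗ[NatAlg δ] Koszul δ q :=
  koszulLift (altD q (koszulForm δ q))

theorem koszulD_koszulForm (q : ℕ) :
    ((koszulD δ q).restrictScalars F).compAlternatingMap (koszulForm δ (q + 1)) =
      altD q (koszulForm δ q) := by
  ext v
  exact koszulLift_koszulForm (δ := δ) (altD q (koszulForm δ q)) v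

/-- The composite corresponds to the form obtained by applying the Chevalley-Eilenberg differential
twice to the universal form, which is zero. -/
theorem koszulD_koszulD (q : ℕ) (z : Koszul δ (q + 2)) : koszulD δ q (koszulD δ (q + 1) z) = 0 := by
  have h : koszulD δ q ∘ₗ koszulD δ (q + 1) = 0 := by
    refine (comp_koszulLift _ _).trans ?_
    rw [← altD_compAlternatingMap ((koszulD δ q).restrictScalars F)
      (fun X m => (koszulD δ q).map_smul _ m), koszulD_koszulForm,
      altD_altD]
    exact koszul_ext fun v => by rw [koszulLift_koszulForm]; rfl
  exact LinearMap.congr_fun h z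

theorem bracketPart_koszulForm (q : ℕ) (v : Fin (q + 1) → L) :
    bracketPart q (koszulForm δ q) v =
      (1 : NatAlg δ) ⊗ₜ[F] bracketPart q (exteriorPower.ιMulti F q) v := by
  cases q with
  | zero => simp [bracketPart]
  | succ q =>
    simp only [bracketPart, TensorProduct.tmul_sum]
    refine Finset.sum_congr rfl fun t _ => Finset.sum_congr rfl fun s _ => ?_
    split_ifs
    · rw [koszulForm_apply, TensorProduct.tmul_smul]
    · rw [TensorProduct.tmul_zero]

/-- The letters v s multiply a on the right, while the bracket terms leave a untouched. Hence, for
the order filtration, the bracket terms are of lower order and the leading part is the classical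
Koszul differential. -/
theorem koszulD_tmul (q : ℕ) (a : NatAlg δ) (v : Fin (q + 1) → L) :
    koszulD δ q (a ⊗ₜ exteriorPower.ιMulti F (q + 1) v) =
      a ⊗ₜ bracketPart q (exteriorPower.ιMulti F q) v +
      ∑ s : Fin (q + 1), (-1 : ℤ) ^ (s : ℕ) •
        (a * NatAlg.ofL δ (v s)) ⊗ₜ exteriorPower.ιMulti F q fun k => v (s.succAbove k) := by
  rw [koszulD, koszulLift_tmul, altD_apply, ceFun, smul_add, bracketPart_koszulForm,
    TensorProduct.smul_tmul', smul_eq_mul, mul_one, actionPart, Finset.smul_sum]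
  congr 1
  refine Finset.sum_congr rfl fun s _ => ?_
  rw [smul_comm, koszul_lie_def, koszulForm_apply, TensorProduct.smul_tmul',
    TensorProduct.smul_tmul', smul_eq_mul, smul_eq_mul, mul_one]

variable {δ}

/-- The decomposable wedges span ⋀^q L, so for each a the condition need only be tested on them. -/
theorem map_koszul_mem {q : ℕ} {B : Type u} [AddCommGroup B] [Module F B]
    {G : Submodule F (NatAlg δ)} {T : Submodule F B} (f : Koszul δ q →ₗ[F] B)
    (h : ∀ a ∈ G, ∀ v, f (a ⊗ₜ exteriorPower.ιMulti F q v) ∈ T) {z : Koszul δ q}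
    (hz : z ∈ tensorSub _ G) : f z ∈ T := by
  refine map_tensorSub f (fun a ha w => ?_) hz
  have h2 : (⊤ : Submodule F (⋀[F]^q L)) ≤ T.comap (f ∘ₗ TensorProduct.mk F (NatAlg δ) _ a) := by
    rw [← exteriorPower.ιMulti_span, Submodule.span_le]
    rintro _ ⟨v, rfl⟩
    exact h a ha v
  exact h2 trivial

theorem exists_mem_koszulFil {q : ℕ} (z : Koszul δ q) : ∃ n, z ∈ tensorSub _ (ordFil δ n) := by
  induction z using TensorProduct.induction_on with
  | zero => exact ⟨0, zero_mem _⟩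
  | tmul a w =>
    obtain ⟨n, hn⟩ := exists_mem_ordFil a
    exact ⟨n, tmul_mem_tensorSub hn w⟩
  | add x y hx hy =>
    obtain ⟨n, hn⟩ := hx
    obtain ⟨m, hm⟩ := hy
    exact ⟨max n m, add_mem (tensorSub_mono (ordFil_mono (le_max_left _ _)) hn)
      (tensorSub_mono (ordFil_mono (le_max_right _ _)) hm)⟩

/-- The map `a ⊗ X ↦ a ⊗ (X ∧ w)`. -/
def wedgeR (q : ℕ) (w : ⋀[F]^q L) : NatAlg δ ⊗[F] L →ₗ[F] Koszul δ (q + 1) :=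
  LinearMap.lTensor _ ((wedge F L q).flip w)

theorem wedgeR_tmul (q : ℕ) (a : NatAlg δ) (X : L) (v : Fin q → L) :
    wedgeR q (exteriorPower.ιMulti F q v) (a ⊗ₜ X) =
      a ⊗ₜ exteriorPower.ιMulti F (q + 1) (Fin.cons X v : Fin (q + 1) → L) := by
  rw [wedgeR, LinearMap.lTensor_tmul, LinearMap.flip_apply, wedge_ιMulti]

theorem wedgeR_mem {q : ℕ} (w : ⋀[F]^q L) {G : Submodule F (NatAlg δ)} {z : NatAlg δ ⊗[F] L}
    (hz : z ∈ tensorSub L G) : wedgeR q w z ∈ tensorSub _ G :=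
  lTensor_mem_tensorSub _ hz

theorem koszulD_zero_wedgeR (z : NatAlg δ ⊗[F] L) (v : Fin 0 → L) :
    koszulD δ 0 (wedgeR 0 (exteriorPower.ιMulti F 0 v) z) =
      mulL δ z ⊗ₜ exteriorPower.ιMulti F 0 v := by
  induction z with
  | zero => simp
  | add x y hx hy => rw [map_add, map_add, hx, hy, map_add, TensorProduct.add_tmul]
  | tmul b Y =>
    rw [wedgeR_tmul, koszulD_tmul, mulL_tmul]
    simp [bracketPart]

/-- Modulo lower order, the differential of `a ⊗ Y ∧ w`. -/
theorem koszulD_wedgeR_mem {q m : ℕ} {z : NatAlg δ ⊗[F] L} (hz : z ∈ tensorSub L (ordFil δ m))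
    (v : Fin (q + 1) → L) :
    koszulD δ (q + 1) (wedgeR (q + 1) (exteriorPower.ιMulti F (q + 1) v) z) -
      (mulL δ z ⊗ₜ exteriorPower.ιMulti F (q + 1) v - ∑ s : Fin (q + 1), (-1 : ℤ) ^ (s : ℕ) •
        wedgeR q (exteriorPower.ιMulti F q fun k => v (s.succAbove k))
          (LinearMap.rTensor L (LinearMap.mulRight F (NatAlg.ofL δ (v s))) z)) ∈
      tensorSub _ (ordFil δ m) := by
  have h := map_tensorSub (V := L) (G := ordFil δ m) (T := tensorSub _ (ordFil δ m))
    ((koszulD δ (q + 1)).restrictScalars F ∘ₗ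
      wedgeR (q + 1) (exteriorPower.ιMulti F (q + 1) v) -
      ((TensorProduct.mk F (NatAlg δ) (⋀[F]^(q + 1) L)).flip
        (exteriorPower.ιMulti F (q + 1) v) ∘ₗ mulL δ -
        ∑ s : Fin (q + 1), (-1 : ℤ) ^ (s : ℕ) •
          (wedgeR q (exteriorPower.ιMulti F q fun k => v (s.succAbove k)) ∘ₗ
          (LinearMap.rTensor L (LinearMap.mulRight F (NatAlg.ofL δ (v s))))))) ?_ hz
  · simpa only [LinearMap.sub_apply, LinearMap.sum_apply, LinearMap.smul_apply,
      LinearMap.comp_apply, LinearMap.flip_apply, TensorProduct.mk_apply,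
      LinearMap.restrictScalars_apply] using h
  · intro b hb Y
    simp only [LinearMap.sub_apply, LinearMap.sum_apply, LinearMap.smul_apply,
      LinearMap.comp_apply, LinearMap.restrictScalars_apply, LinearMap.rTensor_tmul,
      LinearMap.flip_apply, TensorProduct.mk_apply, mulL_tmul, wedgeR_tmul, koszulD_tmul,
      LinearMap.mulRight_apply]
    rw [Fin.sum_univ_succ]
    -- The whole error is the bracket part, which does not raise the order of b. In the action part
    -- the leading summand removes Y and multiplies it into b; the others keep Y in front, which
    -- shifts their sign by -1.
    convert tmul_mem_tensorSub hb (bracketPart (q + 1) (exteriorPower.ιMulti F (q + 1))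
      (Fin.cons Y v : Fin (q + 2) → L)) using 1
    rw [sub_eq_iff_eq_add, add_right_inj, sub_eq_add_neg, ← Finset.sum_neg_distrib]
    congr 1
    · simp
    · refine Finset.sum_congr rfl fun s _ => ?_
      have : (fun k : Fin (q + 1) => (Fin.cons Y v : Fin (q + 2) → L) (s.succ.succAbove k)) =
          Fin.cons Y fun k => v (s.succAbove k) := by
        funext k
        refine Fin.cases ?_ (fun k => ?_) k <;> simp
      rw [this, Fin.cons_succ, Fin.val_succ, pow_succ, mul_neg_one, neg_smul]

variable (δ) in
/-- The homotopy `a ⊗ w ↦ ∑ a₁ ⊗ (p(a₂) ∧ w)`, where `a ↦ ∑ a₁ ⊗ a₂` is the coaction. -/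
def koszulH (p : UniversalEnvelopingAlgebra F L →ₗ[F] L) (q : ℕ) :
    Koszul δ q →ₗ[F] Koszul δ (q + 1) :=
  TensorProduct.lift (((LinearMap.lTensorHom (NatAlg δ)) ∘ₗ (wedge F L q).flip).flip ∘ₗ linPart δ p)

variable {p : UniversalEnvelopingAlgebra F L →ₗ[F] L}

theorem koszulH_tmul (q : ℕ) (a : NatAlg δ) (w : ⋀[F]^q L) :
    koszulH δ p q (a ⊗ₜ w) = wedgeR q w (linPart δ p a) := rfl

variable (hp1 : p 1 = 0) (hpι : ∀ X, p (UniversalEnvelopingAlgebra.ι F X) = X)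
include hp1

/-- The homotopy trades one order for one exterior degree. -/
theorem koszulH_mem {q m : ℕ} {z : Koszul δ q} (hz : z ∈ tensorSub _ (ordFil δ (m + 1))) :
    koszulH δ p q z ∈ tensorSub _ (ordFil δ m) :=
  map_tensorSub _ (fun _ ha w => wedgeR_mem w (linPart_mem hp1 ha)) hz

include hpι

/-- There is no term `koszulH ∘ koszulD` in exterior degree 0, so the factor comes from Euler's
formula alone. -/
theorem koszulD_koszulH_zero_mem {m : ℕ} {z : Koszul δ 0}
    (hz : z ∈ tensorSub _ (ordFil δ (m + 1))) :
    koszulD δ 0 (koszulH δ p 0 z) - (m : F) • z ∈ tensorSub _ (ordFil δ m) :=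
  map_koszul_mem ((koszulD δ 0).restrictScalars F ∘ₗ koszulH δ p 0 - (m : F) • LinearMap.id)
    (fun a ha v => by
      change koszulD δ 0 (koszulH δ p 0 (a ⊗ₜ exteriorPower.ιMulti F 0 v)) -
        (m : F) • (a ⊗ₜ exteriorPower.ιMulti F 0 v) ∈ tensorSub _ (ordFil δ m)
      rw [koszulH_tmul, koszulD_zero_wedgeR, TensorProduct.smul_tmul', ← TensorProduct.sub_tmul]
      exact tmul_mem_tensorSub (mulL_linPart_sub_mem hp1 hpι m ha) _) hz

/-- The homotopy sends a v_s ⊗ v̂_s to two terms by the product rule. One splits a factor off a,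
giving the mixed sum; the other splits off v_s and puts it back in the wedge, and the q + 1 choices
of s give q + 1 copies of a ⊗ v. -/
theorem koszulH_koszulD_mem {q m : ℕ} {a : NatAlg δ} (ha : a ∈ ordFil δ (m + 1))
    (v : Fin (q + 1) → L) :
    koszulH δ p q (koszulD δ q (a ⊗ₜ exteriorPower.ιMulti F (q + 1) v)) -
      (∑ s : Fin (q + 1), (-1 : ℤ) ^ (s : ℕ) •
        wedgeR q (exteriorPower.ιMulti F q fun k => v (s.succAbove k))
          (LinearMap.rTensor L (LinearMap.mulRight F (NatAlg.ofL δ (v s))) (linPart δ p a)) +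
        ((q + 1 : ℕ) : F) • (a ⊗ₜ exteriorPower.ιMulti F (q + 1) v)) ∈
      tensorSub _ (ordFil δ m) := by
  have h0 := koszulH_mem hp1 (tmul_mem_tensorSub ha (bracketPart q (exteriorPower.ιMulti F q) v))
  have h1 : ∀ s : Fin (q + 1), (-1 : ℤ) ^ (s : ℕ) •
      wedgeR q (exteriorPower.ιMulti F q fun k => v (s.succAbove k))
        (linPart δ p (a * NatAlg.ofL δ (v s)) -
        (LinearMap.rTensor L (LinearMap.mulRight F (NatAlg.ofL δ (v s))) (linPart δ p a) +
          a ⊗ₜ v s)) ∈ tensorSub _ (ordFil δ m) := fun s =>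
    zsmul_mem (wedgeR_mem _ (linPart_mul_ofL hp1 hpι ha (v s))) _
  -- Moving v_s from the front back to position s costs (-1)^s, which cancels the sign in the
  -- differential.
  have h2 : ∀ s : Fin (q + 1), (-1 : ℤ) ^ (s : ℕ) •
      wedgeR q (exteriorPower.ιMulti F q fun k => v (s.succAbove k)) (a ⊗ₜ v s) =
        a ⊗ₜ[F] exteriorPower.ιMulti F (q + 1) v := by
    intro s
    have h := (exteriorPower.ιMulti F (q + 1)).neg_one_pow_smul_map_insertNth s (v s)
      (fun k => v (s.succAbove k))
    rw [show s.insertNth (v s) (fun k => v (s.succAbove k)) = v from Fin.insertNth_self_removeNth s v]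
      at h
    rw [wedgeR_tmul, ← TensorProduct.tmul_smul]
    refine congrArg (a ⊗ₜ[F] ·) ?_
    refine (congrArg ((-1 : ℤ) ^ (s : ℕ) • ·) h.symm).trans ?_
    rw [smul_smul, ← pow_add, Even.neg_one_pow ⟨_, rfl⟩, one_smul]
  convert add_mem h0 (sum_mem fun s (_ : s ∈ Finset.univ) => h1 s) using 1
  rw [koszulD_tmul, map_add, map_sum]
  simp only [map_zsmul, koszulH_tmul, map_sub, map_add, smul_sub, smul_add, Finset.sum_sub_distrib,
    Finset.sum_add_distrib, h2]
  rw [Finset.sum_const, Finset.card_univ, Fintype.card_fin, Nat.cast_smul_eq_nsmul F]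
  abel

/-- The mixed sums in `koszulD_wedgeR_mem` and `koszulH_koszulD_mem` have opposite signs and cancel.
What remains is m from Euler's formula and q + 1 from the exterior factor. -/
theorem koszul_homotopy_mem {q m : ℕ} {z : Koszul δ (q + 1)}
    (hz : z ∈ tensorSub _ (ordFil δ (m + 1))) :
    koszulD δ (q + 1) (koszulH δ p (q + 1) z) + koszulH δ p q (koszulD δ q z) -
      ((m + (q + 1) : ℕ) : F) • z ∈ tensorSub _ (ordFil δ m) :=
  map_koszul_mem ((koszulD δ (q + 1)).restrictScalars F ∘ₗ koszulH δ p (q + 1) +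
    koszulH δ p q ∘ₗ (koszulD δ q).restrictScalars F -
    ((m + (q + 1) : ℕ) : F) • LinearMap.id)
    (fun a ha v => by
      change koszulD δ (q + 1) (koszulH δ p (q + 1) (a ⊗ₜ exteriorPower.ιMulti F (q + 1) v)) +
        koszulH δ p q (koszulD δ q (a ⊗ₜ exteriorPower.ιMulti F (q + 1) v)) -
        ((m + (q + 1) : ℕ) : F) • (a ⊗ₜ exteriorPower.ιMulti F (q + 1) v) ∈
          tensorSub _ (ordFil δ m)
      have h1 := koszulD_wedgeR_mem (linPart_mem hp1 ha) v
      have h2 := koszulH_koszulD_mem hp1 hpι ha v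
      have h3 := tmul_mem_tensorSub (mulL_linPart_sub_mem hp1 hpι m ha)
        (exteriorPower.ιMulti F (q + 1) v)
      rw [TensorProduct.sub_tmul, ← TensorProduct.smul_tmul'] at h3
      convert add_mem (add_mem h1 h2) h3 using 1
      rw [koszulH_tmul, Nat.cast_add, add_smul]
      abel) hz

omit hp1 hpι
variable [CharZero F]

/-- Exactness of the Koszul complex in positive degrees. -/
theorem koszul_exact_succ (hδ : Function.Injective δ) (q : ℕ) (z : Koszul δ (q + 1))
    (hz : koszulD δ q z = 0) : ∃ w, koszulD δ (q + 1) w = z := by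
  obtain ⟨p, hp1, hpι⟩ := exists_retraction δ hδ
  obtain ⟨n, hn⟩ := exists_mem_koszulFil z
  induction n generalizing z with
  | zero =>
    obtain rfl : z = 0 := by simpa [ordFil, tensorSub_bot] using hn
    exact ⟨0, map_zero _⟩
  | succ m ih =>
    have hN : ((m + (q + 1) : ℕ) : F) ≠ 0 := Nat.cast_ne_zero.2 (by omega)
    have h1 := koszul_homotopy_mem hp1 hpι hn
    rw [hz, map_zero, add_zero] at h1
    -- For the cycle z of order m, the difference between ∂hz and (m + q + 1) z is again a cycle, of
    -- smaller order, hence a boundary ∂w by induction. Solving for z gives the witness below.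
    obtain ⟨w, hw⟩ := ih _ (by
      have hs := ((koszulD δ q).restrictScalars F).map_smul ((m + (q + 1) : ℕ) : F) z
      change koszulD δ q _ = ((m + (q + 1) : ℕ) : F) • koszulD δ q z at hs
      rw [map_sub, koszulD_koszulD, hs, hz, smul_zero, sub_zero]) h1
    refine ⟨((m + (q + 1) : ℕ) : F)⁻¹ • (koszulH δ p (q + 1) z - w), ?_⟩
    refine (((koszulD δ (q + 1)).restrictScalars F).map_smul _ _).trans ?_
    rw [LinearMap.restrictScalars_apply, map_sub, hw, sub_sub_cancel, smul_smul,
      inv_mul_cancel₀ hN, one_smul]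

/-- In degree `0`, every element of the Koszul complex is homologous to an element of `R`. -/
theorem koszul_exact_zero (hδ : Function.Injective δ) (z : Koszul δ 0) :
    ∃ r w, z = NatAlg.ofR δ r ⊗ₜ exteriorPower.ιMulti F 0 Fin.elim0 + koszulD δ 0 w := by
  obtain ⟨p, hp1, hpι⟩ := exists_retraction δ hδ
  obtain ⟨n, hn⟩ := exists_mem_koszulFil z
  induction n generalizing z with
  | zero =>
    obtain rfl : z = 0 := by simpa [ordFil, tensorSub_bot] using hn
    exact ⟨0, 0, by simp⟩
  | succ m ih =>
    have h1 := koszulD_koszulH_zero_mem hp1 hpι hn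
    -- In order 0 the Euler factor is zero and cannot be inverted, but such a z already lies in R ⊗
    -- ⋀^0 L.
    cases m with
    | zero =>
      let T : Submodule F (Koszul δ 0) := LinearMap.range
        ((TensorProduct.mk F (NatAlg δ) _).flip (exteriorPower.ιMulti F 0 Fin.elim0) ∘ₗ
          (NatAlg.ofR δ).toLinearMap)
      have h2 : z ∈ T := map_koszul_mem LinearMap.id (fun a ha v => by
        rw [Subsingleton.elim v Fin.elim0]
        exact ordFil_succ_le (T := T.comap ((TensorProduct.mk F (NatAlg δ) _).flip
          (exteriorPower.ιMulti F 0 Fin.elim0))) (fun r => ⟨r, rfl⟩) (fun a ha X => by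
            obtain rfl : a = 0 := ha
            rw [zero_mul]
            exact zero_mem _) ha) hn
      obtain ⟨r, hr⟩ := h2
      exact ⟨r, 0, by rw [map_zero, add_zero]; exact hr.symm⟩
    | succ m =>
      have hN : ((m + 1 : ℕ) : F) ≠ 0 := Nat.cast_ne_zero.2 (by omega)
      obtain ⟨r, w, hw⟩ := ih _ h1
      -- Obtained by solving ∂hz - (m + 1) z = r + ∂w for z.
      refine ⟨-(((m + 1 : ℕ) : F)⁻¹ • r), ((m + 1 : ℕ) : F)⁻¹ • (koszulH δ p 0 z - w), ?_⟩
      have hs := ((koszulD δ 0).restrictScalars F).map_smul ((m + 1 : ℕ) : F)⁻¹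
        (koszulH δ p 0 z - w)
      rw [LinearMap.restrictScalars_apply, LinearMap.restrictScalars_apply] at hs
      rw [hs, map_neg, map_smul, TensorProduct.neg_tmul, ← TensorProduct.smul_tmul', ← smul_neg,
        ← smul_add, map_sub, eq_inv_smul_iff₀ hN]
      rw [sub_eq_iff_eq_add] at hw
      rw [hw]
      abel

end KoszulComplex

/-! ### The Koszul complex as a projective resolution of R -/

section KoszulResolution

variable {F : Type u} [Field F] {L : Type u} [LieRing L] [LieAlgebra F L]
  {R : Type u} [CommRing R] [Algebra F R] (δ : L →ₗ⁅F⁆ Derivation F R R)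

open scoped ModuleCat

/-- The terms of the Koszul resolution, as universal Lie-Cartan modules. -/
abbrev koszulObj (q : ℕ) : ULC δ := ModuleCat.of (NatAlg δ) (Koszul δ q)

/-- The Koszul complex, as a chain complex of universal Lie-Cartan modules. -/
def koszulComplex : ChainComplex (ULC δ) ℕ :=
  ChainComplex.of (koszulObj δ) (fun q => ModuleCat.ofHom (koszulD δ q))
    (fun q => ModuleCat.hom_ext (LinearMap.ext (koszulD_koszulD δ q)))

theorem koszulComplex_d (q : ℕ) :
    (koszulComplex δ).d (q + 1) q = ModuleCat.ofHom (koszulD δ q) :=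
  by simp [koszulComplex]

theorem koszulComplex_d_apply (q : ℕ) (z : Koszul δ (q + 1)) :
    (koszulComplex δ).d (q + 1) q z = koszulD δ q z := by
  rw [koszulComplex_d]
  rfl

/-- The augmentation of the Koszul complex. -/
def koszulAug : Koszul δ 0 →ₗ[NatAlg δ] coord δ :=
  koszulLift (AlternatingMap.constOfIsEmpty F L (Fin 0) (show coord δ from (1 : R)))

theorem coord_ofR_smul (r s : R) :
    NatAlg.ofR δ r • (show coord δ from s) = (show coord δ from r * s) :=
  ulcOf_smul δ R _ _ _ _ r s

theorem coord_lie (X : L) (s : R) :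
    ⁅X, (show coord δ from s)⁆ = (show coord δ from δ X s) :=
  ulcOf_lie δ R _ _ _ _ X s

theorem koszulAug_tmul (r : R) (v : Fin 0 → L) :
    koszulAug δ (NatAlg.ofR δ r ⊗ₜ exteriorPower.ιMulti F 0 v) = (show coord δ from r) := by
  refine (koszulLift_tmul _ _ _).trans ?_
  refine (coord_ofR_smul δ r 1).trans ?_
  rw [mul_one]

/-- In exterior degree 1 there are no bracket terms, and the value on the generator X is X(1) = 0.
-/
theorem koszulAug_koszulD (z : Koszul δ 1) : koszulAug δ (koszulD δ 0 z) = 0 := by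
  have h : koszulAug δ ∘ₗ koszulD δ 0 = 0 := by
    refine koszul_ext fun v => ?_
    rw [LinearMap.comp_apply, koszulD, koszulLift_koszulForm, altD_apply, ceFun]
    have h1 : actionPart 0 (koszulForm δ 0) v = NatAlg.ofL δ (v 0) • koszulForm δ 0 Fin.elim0 := by
      rw [actionPart, Fin.sum_univ_one, Fin.val_zero, pow_zero, one_smul,
        Subsingleton.elim (fun k : Fin 0 => v ((0 : Fin 1).succAbove k)) Fin.elim0]
      rfl
    have h2 : bracketPart 0 (koszulForm δ 0) v = 0 := rfl
    rw [h1, h2, zero_add, map_smul, koszulAug, koszulLift_koszulForm]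
    refine (coord_lie δ (v 0) 1).trans ?_
    rw [Derivation.map_one_eq_zero]
    rfl
  exact LinearMap.congr_fun h z

variable {δ} [CharZero F]

theorem koszulComplex_exactAt (hδ : Function.Injective δ) (q : ℕ) :
    (koszulComplex δ).ExactAt (q + 1) := by
  rw [HomologicalComplex.exactAt_iff' _ (q + 2) (q + 1) q (by simp) (by simp),
    ShortComplex.moduleCat_exact_iff]
  intro z hz
  obtain ⟨w, hw⟩ := koszul_exact_succ hδ q z ((koszulComplex_d_apply δ q z).symm.trans hz)
  exact ⟨w, (koszulComplex_d_apply δ (q + 1) w).trans hw⟩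

/-- The Koszul resolution of `R`. -/
def koszulResolution (hδ : Function.Injective δ) : ProjectiveResolution (coord δ) where
  complex := koszulComplex δ
  -- Each term is extended from a vector space over F, hence is free over `NatAlg δ`.
  projective q := (inferInstance : Projective (koszulObj δ q))
  π := (ChainComplex.toSingle₀Equiv _ _).symm ⟨ModuleCat.ofHom (X := Koszul δ 0) (Y := coord δ) (koszulAug δ), by
    rw [koszulComplex_d]
    exact ModuleCat.hom_ext (LinearMap.ext (koszulAug_koszulD δ))⟩
  quasiIso := ⟨fun q => by
    cases q with
    | zero =>
      rw [ChainComplex.quasiIsoAt₀_iff, ShortComplex.quasiIso_iff_of_zeros']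
      · refine ⟨?_, ?_⟩
        · rw [ShortComplex.moduleCat_exact_iff]
          intro z hz
          -- Modulo boundaries z is an element r of R, and the augmentation returns r itself, so a z
          -- in the kernel is a boundary.
          obtain ⟨r, w, rfl⟩ := koszul_exact_zero hδ z
          have h1 : koszulAug δ (NatAlg.ofR δ r ⊗ₜ exteriorPower.ιMulti F 0 Fin.elim0 +
            koszulD δ 0 w) = 0 := hz
          rw [map_add, koszulAug_koszulD, add_zero, koszulAug_tmul] at h1
          obtain rfl : r = 0 := h1
          refine ⟨w, ?_⟩
          refine (koszulComplex_d_apply δ 0 w).trans ?_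
          rw [map_zero, TensorProduct.zero_tmul]
          exact (zero_add (koszulD δ 0 w)).symm
        · rw [ModuleCat.epi_iff_surjective]
          exact fun r => ⟨_, koszulAug_tmul δ r Fin.elim0⟩
      · exact (koszulComplex δ).shape _ _ (by simp)
      · rfl
      · rfl
    | succ q =>
      rw [quasiIsoAt_iff_exactAt' _ _ (ChainComplex.exactAt_succ_single_obj _ _)]
      exact koszulComplex_exactAt hδ q⟩

end KoszulResolution

/-! ### Ext classes represented by cocycles on resolutions -/

section ExtComputations

open Abelian CochainComplex HomComplex

universe w v

variable {C : Type w} [Category.{v} C] [Abelian C] [HasExt.{v} C] {X Y : C}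

/-- Stated with `prev` so that one criterion covers all degrees. In degree 0 the predecessor is 0
itself and the differential from it is zero, so the right-hand side says f = 0. -/
theorem injectiveResolution_extMk_eq_zero_iff (I : InjectiveResolution Y) {n : ℕ}
    (f : X ⟶ I.cocomplex.X n) (hf : f ≫ I.cocomplex.d n (n + 1) = 0) :
    I.extMk f (n + 1) rfl hf = 0 ↔
      ∃ g : X ⟶ I.cocomplex.X ((ComplexShape.up ℕ).prev n), g ≫ I.cocomplex.d _ n = f := by
  cases n with
  | zero =>
    rw [CochainComplex.prev_nat_zero, I.cocomplex.shape 0 0 (by simp)]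
    simp only [Limits.comp_zero]
    refine ⟨fun h => ⟨0, ?_⟩, ?_⟩
    · rw [← I.extEquivCohomologyClass.apply_eq_iff_eq,
        InjectiveResolution.extEquivCohomologyClass_extMk,
        InjectiveResolution.extEquivCohomologyClass_zero, CohomologyClass.mk_eq_zero_iff,
        Cocycle.fromSingleMk_mem_coboundaries_iff _ _ _ _ _ (-1) (by simp)] at h
      obtain ⟨g, hg⟩ := h
      -- A coboundary in degree 0 comes from degree -1, where the resolution extended to ℤ is zero.
      have h0 : Limits.IsZero (I.cochainComplex.X (-1)) :=
        CochainComplex.isZero_of_isStrictlyGE _ 0 _ (by lia)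
      rw [h0.eq_zero_of_tgt g, Limits.zero_comp] at hg
      rw [← cancel_mono (I.cochainComplexXIso 0 0 rfl).inv, Limits.zero_comp]
      exact hg
    · rintro ⟨_, rfl⟩
      exact I.extMk_zero _ _
  | succ n =>
    rw [CochainComplex.prev_nat_succ]
    exact I.extMk_eq_zero_iff f _ rfl hf n rfl

theorem projectiveResolution_extMk_eq_zero_iff (P : ProjectiveResolution X)
    (f : P.complex.X 0 ⟶ Y) (hf : P.complex.d 1 0 ≫ f = 0) :
    P.extMk f 1 rfl hf = 0 ↔ f = 0 := by
  refine ⟨fun h => ?_, ?_⟩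
  · rw [← P.extEquivCohomologyClass.apply_eq_iff_eq,
      ProjectiveResolution.extEquivCohomologyClass_extMk,
      ProjectiveResolution.extEquivCohomologyClass_zero, CohomologyClass.mk_eq_zero_iff,
      Cocycle.toSingleMk_mem_coboundaries_iff _ _ _ _ _ 1 (by simp)] at h
    obtain ⟨g, hg⟩ := h
    -- As a complex indexed by ℤ, the resolution has its n-th term in degree -n, so it vanishes in
    -- degree 1 and only f = 0 can be a coboundary.
    have h0 : Limits.IsZero (P.cochainComplex.X 1) :=
      CochainComplex.isZero_of_isStrictlyLE _ 0 _ (by lia)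
    rw [h0.eq_zero_of_src g, Limits.comp_zero] at hg
    rw [← cancel_epi (P.cochainComplexXIso (-(0 : ℕ)) 0 rfl).hom, Limits.comp_zero]
    exact hg.symm
  · rintro rfl
    exact P.extMk_zero _ _

variable {k : Type*} [CommRing k] [Linear k C]

/-- Scaling a class is precomposition with c times the identity, so compatibility of `extMk` with
precomposition suffices. On the projective side the same is done with postcomposition. -/
theorem injectiveResolution_extMk_smul (I : InjectiveResolution Y) {n : ℕ} (c : k)
    (f : X ⟶ I.cocomplex.X n) (hf : f ≫ I.cocomplex.d n (n + 1) = 0)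
    (hcf : (c • f) ≫ I.cocomplex.d n (n + 1) = 0) :
    I.extMk (c • f) (n + 1) rfl hcf = c • I.extMk f (n + 1) rfl hf := by
  have h := I.mk₀_comp_extMk f (n + 1) rfl hf (c • 𝟙 X)
  rw [Ext.mk₀_smul, Ext.smul_comp, Ext.mk₀_id_comp] at h
  rw [h]
  congr 1
  simp

theorem projectiveResolution_extMk_smul (P : ProjectiveResolution X) {n : ℕ} (c : k)
    (f : P.complex.X n ⟶ Y) (hf : P.complex.d (n + 1) n ≫ f = 0)
    (hcf : P.complex.d (n + 1) n ≫ (c • f) = 0) :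
    P.extMk (c • f) (n + 1) rfl hcf = c • P.extMk f (n + 1) rfl hf := by
  have h := P.extMk_comp_mk₀ f (n + 1) rfl hf (c • 𝟙 Y)
  rw [← Ext.smul_eq_comp_mk₀] at h
  rw [h]
  congr 1
  simp

end ExtComputations

/-! ### Homology of a complex of modules through cocycles and coboundaries -/

section Homology

universe v

variable {A : Type u} [Ring A]

/-- An additive bijection out of the homology of a complex of modules, from a surjective additive
function on cocycles vanishing exactly on coboundaries. -/
theorem exists_homologyEquiv (K : CochainComplex (ModuleCat.{u} A) ℕ) (q : ℕ) {E : Type v}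
    [AddCommGroup E] (t : ∀ x : K.X q, K.d q (q + 1) x = 0 → E)
    (hadd : ∀ x y hx hy hxy, t (x + y) hxy = t x hx + t y hy)
    (hsurj : ∀ e, ∃ x hx, t x hx = e)
    (hker : ∀ x hx, t x hx = 0 ↔ ∃ y : K.X ((ComplexShape.up ℕ).prev q), K.d _ q y = x) :
    ∃ e : K.homology q ≃+ E, ∀ (z : K.cycles q) (hz : K.d q (q + 1) (K.iCycles q z) = 0),
      e (K.homologyπ q z) = t (K.iCycles q z) hz := by
  have hd : ∀ z : K.cycles q, K.d q (q + 1) (K.iCycles q z) = 0 := fun z => by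
    rw [← ModuleCat.comp_apply, K.iCycles_d]
    rfl
  let T : K.cycles q →+ E := AddMonoidHom.mk' (fun z => t (K.iCycles q z) (hd z)) fun z z' => by
    have h := map_add (K.iCycles q).hom z z'
    -- The function t also takes a proof as argument, so equal cocycles have to be substituted
    -- before additivity applies.
    have : ∀ (a b : K.X q) (h : a = b) (ha hb), t a ha = t b hb := by
      rintro a _ rfl _ _
      rfl
    rw [this _ _ h _ (by rw [← h]; exact hd _)]
    exact hadd _ _ _ _ _
  let π : K.cycles q →+ K.homology q := (K.homologyπ q).hom.toAddMonoidHom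
  have hπ : Function.Surjective π := (ModuleCat.epi_iff_surjective _).1 inferInstance
  have hT : Function.Surjective T := by
    intro e
    obtain ⟨x, hx, rfl⟩ := hsurj e
    have hx' : (K.sc q).g x = 0 := by
      change K.d q ((ComplexShape.up ℕ).next q) x = 0
      rw [CochainComplex.next]
      exact hx
    refine ⟨(K.sc q).moduleCatCyclesIso.inv ⟨x, hx'⟩, ?_⟩
    have h : K.iCycles q ((K.sc q).moduleCatCyclesIso.inv ⟨x, hx'⟩) = x :=
      (K.sc q).moduleCatCyclesIso_inv_iCycles_apply ⟨x, hx'⟩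
    change t (K.iCycles q _) _ = _
    congr 1
  -- Both maps out of the cycles are surjective; once their kernels agree, homology and E are the
  -- same quotient.
  have hk : T.ker = π.ker := by
    ext z
    rw [AddMonoidHom.mem_ker, AddMonoidHom.mem_ker]
    refine (hker _ _).trans ?_
    have h1 := (K.sc q).moduleCatCyclesIso_hom_i_apply z
    have h2 := (K.sc q).π_moduleCatCyclesIso_hom_apply z
    have h3 : π z = 0 ↔ (K.sc q).moduleCatHomologyIso.hom (π z) = 0 :=
      (K.sc q).moduleCatHomologyIso.toLinearEquiv.map_eq_zero_iff.symm
    have h4 : (K.sc q).moduleCatHomologyIso.hom (π z) =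
      (K.sc q).moduleCatLeftHomologyData.π ((K.sc q).moduleCatCyclesIso.hom z) := h2
    rw [h3, h4]
    refine Iff.trans ?_ (Submodule.Quotient.mk_eq_zero _).symm
    constructor
    · rintro ⟨y, hy⟩
      exact ⟨y, Subtype.ext (hy.trans h1.symm)⟩
    · rintro ⟨y, hy⟩
      exact ⟨y, (congrArg Subtype.val hy).trans h1⟩
  refine ⟨(QuotientAddGroup.quotientKerEquivOfSurjective π hπ).symm.trans
    ((QuotientAddGroup.quotientAddEquivOfEq hk.symm).trans
      (QuotientAddGroup.quotientKerEquivOfSurjective T hT)), fun z hz => ?_⟩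
  have h : (QuotientAddGroup.quotientKerEquivOfSurjective π hπ).symm (π z) =
      QuotientAddGroup.mk z := by
    rw [AddEquiv.symm_apply_eq]
    rfl
  change (QuotientAddGroup.quotientAddEquivOfEq hk.symm).trans
      (QuotientAddGroup.quotientKerEquivOfSurjective T hT)
      ((QuotientAddGroup.quotientKerEquivOfSurjective π hπ).symm (π z)) = _
  rw [h]
  rfl

theorem homologyπ_surjective (K : CochainComplex (ModuleCat.{u} A) ℕ) (q : ℕ) (x : K.homology q) :
    ∃ z, K.homologyπ q z = x :=
  (ModuleCat.epi_iff_surjective (K.homologyπ q)).1 inferInstance x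

end Homology

/-! ### Comparing two functors through a common target -/

section Comparison

/-- Two functors to `R`-modules are isomorphic if both are in natural additive bijection, semilinear
along a map `ω : R → k`, with the same family of `k`-modules. -/
theorem nonempty_iso_of_equivs {C : Type*} [Category C] {R k : Type u} [CommRing R] [CommRing k]
    (ω : R → k) (Φ Ψ : C ⥤ ModuleCat.{u} R) (E : C → Type*) [∀ M, AddCommGroup (E M)]
    [∀ M, Module k (E M)] (T : ∀ {M N : C}, (M ⟶ N) → E M → E N)
    (a : ∀ M, Φ.obj M ≃+ E M) (b : ∀ M, Ψ.obj M ≃+ E M)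
    (ha : ∀ M (r : R) x, a M (r • x) = ω r • a M x)
    (hb : ∀ M (r : R) x, b M (r • x) = ω r • b M x)
    (ha' : ∀ {M N : C} (f : M ⟶ N) x, a N (Φ.map f x) = T f (a M x))
    (hb' : ∀ {M N : C} (f : M ⟶ N) x, b N (Ψ.map f x) = T f (b M x)) : Nonempty (Φ ≅ Ψ) := by
  let e : ∀ M, Φ.obj M ≃ₗ[R] Ψ.obj M := fun M =>
    { (a M).trans (b M).symm with
      map_smul' := fun r x => by
        change (b M).symm (a M (r • x)) = r • (b M).symm (a M x)
        rw [AddEquiv.symm_apply_eq, hb, AddEquiv.apply_symm_apply, ha] }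
  refine ⟨NatIso.ofComponents (fun M => (e M).toModuleIso) fun {M N} f => ?_⟩
  refine ModuleCat.hom_ext (LinearMap.ext fun x => ?_)
  change (b N).symm (a N (Φ.map f x)) = Ψ.map f ((b M).symm (a M x))
  rw [AddEquiv.symm_apply_eq, hb', AddEquiv.apply_symm_apply, ha']

end Comparison

/-! ### Chevalley-Eilenberg cohomology as Ext, via the Koszul resolution -/

section ChevalleyEilenbergExt

open scoped ModuleCat

variable {F : Type u} [Field F] {L : Type u} [LieRing L] [LieAlgebra F L]
  {R : Type u} [CommRing R] [Algebra F R] {δ : L →ₗ⁅F⁆ Derivation F R R}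

/-- The morphism out of a term of the Koszul complex attached to an alternating form. -/
def formHom {M : ULC δ} {q : ℕ} (φ : L [⋀^Fin q]→ₗ[F] M) : koszulObj δ q ⟶ M :=
  ModuleCat.ofHom (X := Koszul δ q) (Y := M) (koszulLift φ)

theorem formHom_ext {M : ULC δ} {q : ℕ} {f g : koszulObj δ q ⟶ M}
    (h : ∀ v, f.hom (koszulForm δ q v) = g.hom (koszulForm δ q v)) : f = g :=
  ModuleCat.hom_ext (koszul_ext h)

theorem formHom_koszulForm {M : ULC δ} {q : ℕ} (φ : L [⋀^Fin q]→ₗ[F] M) (v : Fin q → L) :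
    (formHom φ).hom (koszulForm δ q v) = φ v := koszulLift_koszulForm φ v

theorem formHom_injective {M : ULC δ} {q : ℕ} :
    Function.Injective (formHom : (L [⋀^Fin q]→ₗ[F] M) → (koszulObj δ q ⟶ M)) := fun φ ψ h => by
  ext v
  rw [← formHom_koszulForm, h, formHom_koszulForm]

theorem formHom_surjective {M : ULC δ} {q : ℕ} (f : koszulObj δ q ⟶ M) :
    ∃ φ : L [⋀^Fin q]→ₗ[F] M, formHom φ = f :=
  ⟨(LinearMap.restrictScalars F (M := Koszul δ q) (M₂ := M) f.hom).compAlternatingMap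
    (koszulForm δ q), formHom_ext fun v => by
      rw [formHom_koszulForm]
      rfl⟩

theorem formHom_add {M : ULC δ} {q : ℕ} (φ ψ : L [⋀^Fin q]→ₗ[F] M) :
    formHom (φ + ψ) = formHom φ + formHom ψ :=
  formHom_ext fun v => by
    rw [formHom_koszulForm, ModuleCat.hom_add, LinearMap.add_apply, formHom_koszulForm,
      formHom_koszulForm]
    rfl

theorem formHom_zero {M : ULC δ} {q : ℕ} :
    formHom (0 : L [⋀^Fin q]→ₗ[F] M) = (0 : koszulObj δ q ⟶ M) :=
  formHom_ext fun v => formHom_koszulForm _ v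

theorem formHom_smul {M : ULC δ} {q : ℕ} (c : F) (φ : L [⋀^Fin q]→ₗ[F] M) :
    formHom (c • φ) = c • formHom φ :=
  formHom_ext fun v => by
    rw [formHom_koszulForm]
    refine Eq.trans ?_ (congrArg (c • ·) (formHom_koszulForm φ v)).symm
    rfl

theorem formHom_comp {M N : ULC δ} {q : ℕ} (φ : L [⋀^Fin q]→ₗ[F] M) (f : M ⟶ N) :
    formHom φ ≫ f = formHom ((homF f).compAlternatingMap φ) :=
  formHom_ext fun v => by
    rw [formHom_koszulForm, ModuleCat.hom_comp, LinearMap.comp_apply, formHom_koszulForm]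
    rfl

/-- The form φ is the image of the universal form under the L-equivariant map `koszulLift φ`. The
differential commutes with such maps, and `koszulD` was defined through the differential of the
universal form. -/
theorem koszulComplex_d_formHom {M : ULC δ} {q : ℕ} (φ : L [⋀^Fin q]→ₗ[F] M) :
    (koszulComplex δ).d (q + 1) q ≫ formHom φ = formHom (altD q φ) := by
  rw [koszulComplex_d]
  refine formHom_ext fun v => ?_
  rw [formHom_koszulForm]
  have h := altD_compAlternatingMap (LinearMap.restrictScalars F (koszulLift φ))
    (fun X m => (koszulLift φ).map_smul (NatAlg.ofL δ X) m) q (koszulForm δ q)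
  have h2 : (LinearMap.restrictScalars F (koszulLift φ)).compAlternatingMap (koszulForm δ q) = φ :=
    AlternatingMap.ext (koszulLift_koszulForm φ)
  rw [h2] at h
  rw [h]
  change koszulLift φ (koszulD δ q (koszulForm δ (q + 1) v)) = _
  rw [koszulD, koszulLift_koszulForm]
  rfl

variable [CharZero F] (hδ : Function.Injective δ)

theorem koszulResolution_d_cochain {M : ULC δ} {q : ℕ} (φ : Cochain M q) :
    (koszulResolution hδ).complex.d (q + 1) q ≫ formHom ((cochainEquiv M q).symm φ) =
      formHom ((cochainEquiv M (q + 1)).symm (cochainD M q φ)) := by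
  refine (koszulComplex_d_formHom _).trans (congrArg formHom ?_)
  simp [cochainD]

/-- The class in `Ext^q(R, M)` of a Chevalley-Eilenberg cocycle. -/
def ceClass (M : ULC δ) (q : ℕ) (φ : Cochain M q) (h : cochainD M q φ = 0) :
    Abelian.Ext.{u} (coord δ) M q :=
  (koszulResolution hδ).extMk (formHom ((cochainEquiv M q).symm φ)) (q + 1) rfl (by
    rw [koszulResolution_d_cochain, h, map_zero]
    exact formHom_zero)

theorem ceClass_add {M : ULC δ} {q : ℕ} (φ ψ : Cochain M q) (hφ hψ h) :
    ceClass hδ M q (φ + ψ) h = ceClass hδ M q φ hφ + ceClass hδ M q ψ hψ := by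
  refine Eq.trans ?_ (ProjectiveResolution.add_extMk _ _ _ _ _ _ _).symm
  unfold ceClass
  congr 1
  rw [map_add]
  exact formHom_add _ _

theorem ceClass_smul {M : ULC δ} {q : ℕ} (c : F) (φ : Cochain M q) (hφ h) :
    ceClass hδ M q (c • φ) h = c • ceClass hδ M q φ hφ := by
  refine Eq.trans ?_ (projectiveResolution_extMk_smul _ _ _ _ ?_)
  · unfold ceClass
    congr 1
    rw [map_smul]
    exact formHom_smul _ _
  · refine (Linear.comp_smul _ _ _ _ _ _).trans ?_
    rw [koszulResolution_d_cochain, hφ, map_zero]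
    exact (congrArg (c • ·) formHom_zero).trans (smul_zero c)

theorem ceClass_map {M N : ULC δ} (f : M ⟶ N) {q : ℕ} (φ : Cochain M q) (hφ h) :
    ceClass hδ N q (cochainMap f q φ) h =
      (ceClass hδ M q φ hφ).comp (Abelian.Ext.mk₀ f) (add_zero q) := by
  refine Eq.trans ?_ (ProjectiveResolution.extMk_comp_mk₀ _ _ _ _ _ _).symm
  unfold ceClass
  congr 1
  obtain ⟨ψ, rfl⟩ := (cochainEquiv M q).surjective φ
  rw [cochainMap_cochainEquiv, LinearEquiv.symm_apply_apply, LinearEquiv.symm_apply_apply]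
  exact (formHom_comp _ _).symm

theorem ceClass_surjective {M : ULC δ} {q : ℕ} (α : Abelian.Ext.{u} (coord δ) M q) :
    ∃ φ h, ceClass hδ M q φ h = α := by
  obtain ⟨f, hf, rfl⟩ := (koszulResolution hδ).extMk_surjective α (q + 1) rfl
  obtain ⟨ψ, rfl⟩ := formHom_surjective f
  have hψ : altD q ψ = 0 := formHom_injective (((koszulComplex_d_formHom ψ).symm.trans hf).trans
    formHom_zero.symm)
  refine ⟨cochainEquiv M q ψ, by simp [cochainD, hψ], ?_⟩
  unfold ceClass
  congr 1
  rw [LinearEquiv.symm_apply_apply]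

theorem ceClass_zero_eq_zero_iff {M : ULC δ} (φ : Cochain M 0) (h) :
    ceClass hδ M 0 φ h = 0 ↔ φ = 0 := by
  refine (projectiveResolution_extMk_eq_zero_iff _ _ _).trans ⟨fun h => ?_, ?_⟩
  · refine (cochainEquiv M 0).symm.injective (formHom_injective (h.trans ?_))
    rw [map_zero]
    exact formHom_zero.symm
  · rintro rfl
    rw [map_zero]
    exact formHom_zero

/-- Every morphism from the previous Koszul term comes from a form, so coboundaries of Hom(P, M) and
of the Chevalley-Eilenberg complex correspond. -/
theorem ceClass_succ_eq_zero_iff {M : ULC δ} {q : ℕ} (φ : Cochain M (q + 1)) (h) :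
    ceClass hδ M (q + 1) φ h = 0 ↔ ∃ ψ, cochainD M q ψ = φ := by
  refine ((koszulResolution hδ).extMk_eq_zero_iff _ _ rfl _ q rfl).trans ⟨?_, ?_⟩
  · rintro ⟨g, hg⟩
    obtain ⟨ψ, rfl⟩ := formHom_surjective g
    refine ⟨cochainEquiv M q ψ, (cochainEquiv M (q + 1)).symm.injective (formHom_injective ?_)⟩
    rw [← hg, ← koszulResolution_d_cochain hδ, LinearEquiv.symm_apply_apply]
  · rintro ⟨ψ, rfl⟩
    exact ⟨_, koszulResolution_d_cochain hδ ψ⟩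

/-- The cohomology of the extended Chevalley-Eilenberg complex is `Ext(R, M)`. -/
theorem exists_ceCohomology_equiv (ω : R →ₐ[F] F) (M : ULC δ) (q : ℕ) :
    ∃ e : (ceCohomology δ ω q).obj M ≃+ Abelian.Ext.{u} (coord δ) M q,
      ∀ (z : ((ceComplex δ ω).obj M).cycles q) (φ : Cochain M q) (h : cochainD M q φ = 0),
        φ = ((ceComplex δ ω).obj M).iCycles q z →
          e (((ceComplex δ ω).obj M).homologyπ q z) = ceClass hδ M q φ h := by
  have hd : ∀ (q : ℕ) (φ : Cochain M q),
      ((ceComplex δ ω).obj M).d q (q + 1) φ = cochainD M q φ := by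
    intro q φ
    have : ((ceComplex δ ω).obj M).d q (q + 1) = ceD δ ω M q := by simp [ceComplex]
    rw [this]
    rfl
  obtain ⟨e, he⟩ := exists_homologyEquiv ((ceComplex δ ω).obj M) q
    (fun φ h => ceClass hδ M q φ ((hd q φ).symm.trans h))
    (fun φ ψ _ _ _ => ceClass_add hδ φ ψ _ _ _)
    (fun α => by
      obtain ⟨φ, h, rfl⟩ := ceClass_surjective hδ α
      exact ⟨φ, (hd q φ).trans h, rfl⟩)
    (fun φ h => by
      cases q with
      | zero =>
        refine (ceClass_zero_eq_zero_iff hδ φ _).trans ?_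
        rw [CochainComplex.prev_nat_zero, ((ceComplex δ ω).obj M).shape 0 0 (by simp)]
        exact ⟨fun h => ⟨0, h.symm⟩, fun ⟨_, h⟩ => h.symm⟩
      | succ q =>
        refine (ceClass_succ_eq_zero_iff hδ φ _).trans ?_
        rw [CochainComplex.prev_nat_succ]
        exact ⟨fun ⟨ψ, h⟩ => ⟨ψ, (hd q ψ).trans h⟩, fun ⟨ψ, h⟩ => ⟨ψ, (hd q ψ).symm.trans h⟩⟩)
  refine ⟨e, fun z φ h hφ => ?_⟩
  subst hφ
  exact he z ((hd q _).trans h)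

end ChevalleyEilenbergExt

/-! ### The derived functors of Γ as Ext, via injective resolutions -/

section DerivedFunctorExt

open scoped ModuleCat

variable {F : Type u} [Field F] {L : Type u} [LieRing L] [LieAlgebra F L]
  {R : Type u} [CommRing R] [Algebra F R] {δ : L →ₗ⁅F⁆ Derivation F R R}

/-- The complex `Γ(I)` for an injective resolution `I`. -/
abbrev gammaComplex (ω : R →ₐ[F] F) {M : ULC δ} (I : InjectiveResolution M) :
    CochainComplex (GRMod F L R) ℕ :=
  ((homFromR δ ω).mapHomologicalComplex _).obj I.cocomplex

/-- The cohomology of `Γ(I)` is `Ext(R, M)`. -/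
theorem exists_gammaComplex_equiv (ω : R →ₐ[F] F) {M : ULC δ} (I : InjectiveResolution M)
    (q : ℕ) :
    ∃ e : (gammaComplex ω I).homology q ≃+ Abelian.Ext.{u} (coord δ) M q,
      ∀ (z : (gammaComplex ω I).cycles q) (f : coord δ ⟶ I.cocomplex.X q)
        (h : f ≫ I.cocomplex.d q (q + 1) = 0), f = (gammaComplex ω I).iCycles q z →
          e ((gammaComplex ω I).homologyπ q z) = I.extMk f (q + 1) rfl h := by
  obtain ⟨e, he⟩ := exists_homologyEquiv (gammaComplex ω I) q
    (fun (f : coord δ ⟶ I.cocomplex.X q) h => I.extMk f (q + 1) rfl h)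
    (fun f g hf hg h => (I.add_extMk f g (q + 1) rfl hf hg).symm)
    (fun α => by
      obtain ⟨f, h, rfl⟩ := I.extMk_surjective α (q + 1) rfl
      exact ⟨f, h, rfl⟩)
    (fun f h => injectiveResolution_extMk_eq_zero_iff I f h)
  refine ⟨e, fun z f h hf => ?_⟩
  subst hf
  exact he z h

end DerivedFunctorExt

/-! ### Naturality, R-linearity and the comparison theorem -/

section Comparison

open scoped ModuleCat

variable {F : Type u} [Field F] {L : Type u} [LieRing L] [LieAlgebra F L]
  {R : Type u} [CommRing R] [Algebra F R] {δ : L →ₗ⁅F⁆ Derivation F R R}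

theorem ofUnity_ofR_smul {ω : R →ₐ[F] F} {V : Type u} [AddCommGroup V] [Module F V]
    (ρ : L →ₗ[F] Module.End F V) (hρ : ∀ X Y, ρ ⁅X, Y⁆ = ρ X * ρ Y - ρ Y * ρ X) (r : R) (v : V) :
    (GRAlg.ofR F L R r • (show GRMod.ofUnity ω ρ hρ from v) : GRMod.ofUnity ω ρ hρ) =
      (show GRMod.ofUnity ω ρ hρ from ω r • v) := by
  change GRMod.unityAction ω ρ hρ (GRAlg.ofR F L R r) v = ω r • v
  rw [GRMod.unityAction, GRAlg.lift_ofR]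
  rfl

/-- The bijections are known on classes of cycles, and every homology class is one, so linearity and
naturality are checked on cocycles. The algebra R acts on cochains through ω, which turns
R-linearity into the F-linearity `ceClass_smul`. -/
theorem exists_ceCohomology_natural_equiv [CharZero F] (hδ : Function.Injective δ)
    (ω : R →ₐ[F] F) (q : ℕ) :
    ∃ e : ∀ M, (ceCohomology δ ω q).obj M ≃+ Abelian.Ext.{u} (coord δ) M q,
      (∀ M r x, e M (GRAlg.ofR F L R r • x) = ω r • e M x) ∧
      ∀ {M N : ULC δ} (f : M ⟶ N) x, e N ((ceCohomology δ ω q).map f x) =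
        (e M x).comp (Abelian.Ext.mk₀ f) (add_zero q) := by
  choose e he using fun M : ULC δ => exists_ceCohomology_equiv hδ ω M q
  have hz : ∀ (M : ULC δ) (z : ((ceComplex δ ω).obj M).cycles q),
      cochainD M q (((ceComplex δ ω).obj M).iCycles q z) = 0 := by
    intro M z
    have h1 := LinearMap.congr_fun (congrArg ModuleCat.Hom.hom
      (((ceComplex δ ω).obj M).iCycles_d q (q + 1))) z
    have h2 : ((ceComplex δ ω).obj M).d q (q + 1) = ceD δ ω M q := by simp [ceComplex]
    rw [h2] at h1
    exact h1
  refine ⟨e, fun M r x => ?_, fun {M N} f x => ?_⟩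
  · obtain ⟨z, rfl⟩ := homologyπ_surjective _ q x
    have h1 : (ω r • (show Cochain M q from ((ceComplex δ ω).obj M).iCycles q z) : Cochain M q) =
        ((ceComplex δ ω).obj M).iCycles q (GRAlg.ofR F L R r • z) :=
      (ofUnity_ofR_smul (cochainLie M q) (cochainLie_lie M q) r _).symm.trans
        ((((ceComplex δ ω).obj M).iCycles q).hom.map_smul _ z).symm
    have h2 : (GRAlg.ofR F L R r • ((ceComplex δ ω).obj M).homologyπ q z) =
        ((ceComplex δ ω).obj M).homologyπ q (GRAlg.ofR F L R r • z) :=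
      ((((ceComplex δ ω).obj M).homologyπ q).hom.map_smul _ z).symm
    refine (congrArg (e M) h2).trans ?_
    rw [he M z _ (hz M z) rfl, he M _ _ (by rw [h1]; exact hz M _) h1]
    exact ceClass_smul hδ _ _ _ _
  · obtain ⟨z, rfl⟩ := homologyπ_surjective _ q x
    have h1 : cochainMap f q (((ceComplex δ ω).obj M).iCycles q z) =
        ((ceComplex δ ω).obj N).iCycles q
          (HomologicalComplex.cyclesMap ((ceComplex δ ω).map f) q z) :=
      (LinearMap.congr_fun (congrArg ModuleCat.Hom.hom
        (HomologicalComplex.cyclesMap_i ((ceComplex δ ω).map f) q)) z).symm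
    have h2 : (ceCohomology δ ω q).map f (((ceComplex δ ω).obj M).homologyπ q z) =
        ((ceComplex δ ω).obj N).homologyπ q
          (HomologicalComplex.cyclesMap ((ceComplex δ ω).map f) q z) :=
      LinearMap.congr_fun (congrArg ModuleCat.Hom.hom
        (HomologicalComplex.homologyπ_naturality ((ceComplex δ ω).map f) q)) z
    refine (congrArg (e N) h2).trans ?_
    rw [he M z _ (hz M z) rfl, he N _ _ (by rw [h1]; exact hz N _) h1]
    exact ceClass_map hδ f _ _ _

/-- An injective resolution is fixed for each M, and the derived functor is read off from it.
Naturality comes from lifting f to the chosen resolutions; such a lift induces both the map of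
derived functors and the composition with f in Ext. -/
theorem exists_ulcCohomology_natural_equiv (ω : R →ₐ[F] F) (q : ℕ) :
    ∃ e : ∀ M, (ulcCohomology δ ω q).obj M ≃+ Abelian.Ext.{u} (coord δ) M q,
      (∀ M r x, e M (GRAlg.ofR F L R r • x) = ω r • e M x) ∧
      ∀ {M N : ULC δ} (f : M ⟶ N) x, e N ((ulcCohomology δ ω q).map f x) =
        (e M x).comp (Abelian.Ext.mk₀ f) (add_zero q) := by
  let I : ∀ M : ULC δ, InjectiveResolution M := fun M => injectiveResolution M
  choose e he using fun M : ULC δ => exists_gammaComplex_equiv ω (I M) q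
  let j : ∀ M : ULC δ, (ulcCohomology δ ω q).obj M ≅ (gammaComplex ω (I M)).homology q :=
    fun M => (I M).isoRightDerivedObj (homFromR δ ω) q
  have hz : ∀ (M : ULC δ) (z : (gammaComplex ω (I M)).cycles q),
      (show coord δ ⟶ (I M).cocomplex.X q from (gammaComplex ω (I M)).iCycles q z) ≫
        (I M).cocomplex.d q (q + 1) = 0 := fun M z =>
    LinearMap.congr_fun (congrArg ModuleCat.Hom.hom
      ((gammaComplex ω (I M)).iCycles_d q (q + 1))) z
  refine ⟨fun M => (j M).toLinearEquiv.toAddEquiv.trans (e M), fun M r x => ?_,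
    fun {M N} f x => ?_⟩
  · change e M ((j M).toLinearEquiv (GRAlg.ofR F L R r • x)) = ω r • e M ((j M).toLinearEquiv x)
    rw [map_smul]
    obtain ⟨z, hx⟩ := homologyπ_surjective _ q ((j M).toLinearEquiv x)
    rw [← hx]
    have h1 : (ω r • (show coord δ ⟶ (I M).cocomplex.X q from
        (gammaComplex ω (I M)).iCycles q z) : coord δ ⟶ (I M).cocomplex.X q) =
        (gammaComplex ω (I M)).iCycles q (GRAlg.ofR F L R r • z) :=
      (ofUnity_ofR_smul (L := L) 0 (by simp) r _).symm.trans
        (((gammaComplex ω (I M)).iCycles q).hom.map_smul _ z).symm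
    have h2 : (GRAlg.ofR F L R r • (gammaComplex ω (I M)).homologyπ q z) =
        (gammaComplex ω (I M)).homologyπ q (GRAlg.ofR F L R r • z) :=
      (((gammaComplex ω (I M)).homologyπ q).hom.map_smul _ z).symm
    refine (congrArg (e M) h2).trans ?_
    rw [he M z _ (hz M z) rfl, he M _ _ (by rw [h1]; exact hz M _) h1]
    exact injectiveResolution_extMk_smul _ _ _ _ _
  · let φ : (I M).cocomplex ⟶ (I N).cocomplex := InjectiveResolution.desc f (I N) (I M)
    have hφ : (I M).ι.f 0 ≫ φ.f 0 = f ≫ (I N).ι.f 0 :=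
      InjectiveResolution.desc_commutes_zero f (I N) (I M)
    -- The same lift φ is packaged a second time in the form required by the naturality of `extMk`.
    let ψ : InjectiveResolution.Hom (I M) (I N) f := ⟨φ, hφ⟩
    let Φ : gammaComplex ω (I M) ⟶ gammaComplex ω (I N) :=
      ((homFromR δ ω).mapHomologicalComplex _).map φ
    have h0 : (j N).hom ((ulcCohomology δ ω q).map f x) =
        HomologicalComplex.homologyMap Φ q ((j M).hom x) :=
      LinearMap.congr_fun (congrArg ModuleCat.Hom.hom
        (InjectiveResolution.isoRightDerivedObj_hom_naturality f (I M) (I N) φ hφ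
          (homFromR δ ω) q)) x
    change e N ((j N).hom ((ulcCohomology δ ω q).map f x)) =
      (e M ((j M).hom x)).comp (Abelian.Ext.mk₀ f) (add_zero q)
    rw [h0]
    obtain ⟨z, hx⟩ := homologyπ_surjective _ q ((j M).hom x)
    rw [← hx]
    have h1 : (show coord δ ⟶ (I M).cocomplex.X q from (gammaComplex ω (I M)).iCycles q z) ≫
        φ.f q = (gammaComplex ω (I N)).iCycles q (HomologicalComplex.cyclesMap Φ q z) :=
      (LinearMap.congr_fun (congrArg ModuleCat.Hom.hom
        (HomologicalComplex.cyclesMap_i Φ q)) z).symm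
    have h2 : HomologicalComplex.homologyMap Φ q ((gammaComplex ω (I M)).homologyπ q z) =
        (gammaComplex ω (I N)).homologyπ q (HomologicalComplex.cyclesMap Φ q z) :=
      LinearMap.congr_fun (congrArg ModuleCat.Hom.hom
        (HomologicalComplex.homologyπ_naturality Φ q)) z
    refine (congrArg (e N) h2).trans ?_
    rw [he M z _ (hz M z) rfl, he N _ _ (by rw [h1]; exact hz N _) h1]
    exact (InjectiveResolution.extMk_comp_mk₀ _ _ _ _ ψ).symm

/-- The comparison theorem for an arbitrary Lie algebra acting faithfully by derivations. -/
theorem nonempty_ulcCohomology_iso_ceCohomology [CharZero F] (hδ : Function.Injective δ)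
    (ω : R →ₐ[F] F) (q : ℕ) :
    Nonempty (ulcCohomology δ ω q ⋙ GRMod.toRMod F L R ≅
      ceCohomology δ ω q ⋙ GRMod.toRMod F L R) := by
  obtain ⟨a, ha, ha'⟩ := exists_ulcCohomology_natural_equiv (δ := δ) ω q
  obtain ⟨b, hb, hb'⟩ := exists_ceCohomology_natural_equiv hδ ω q
  exact nonempty_iso_of_equivs (k := F) ω _ _ (fun M => Abelian.Ext.{u} (coord δ) M q)
    (fun f x => x.comp (Abelian.Ext.mk₀ f) (add_zero q)) a b ha hb ha' hb'

end Comparison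

end UniversalLieCartan

end

/-- The Lie algebra g consists of derivations of the polynomial ring, so its action is faithful by
definition and the general comparison applies. -/
theorem mainTheorem2 (F : Type u) [Field F] [IsAlgClosed F] [CharZero F] (n : ℕ) (hn : 0 < n)
    (g : LieSubalgebra F (UniversalLieCartan.W F n))
    (hg : UniversalLieCartan.IsVectorFieldAlgebra F n g) (q : ℕ) :
    Nonempty
      (UniversalLieCartan.ulcCohomology g.incl (UniversalLieCartan.unity F n) q ⋙
          UniversalLieCartan.GRMod.toRMod F g (MvPolynomial (Fin n) F) ≅
        UniversalLieCartan.ceCohomology g.incl (UniversalLieCartan.unity F n) q ⋙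
          UniversalLieCartan.GRMod.toRMod F g (MvPolynomial (Fin n) F)) :=
  UniversalLieCartan.nonempty_ulcCohomology_iso_ceCohomology Subtype.val_injective _ q
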